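/- **Setting.** Let $(N,C,A_1,A_2,\ldots)$ be a random vector with $N\in\{0,1,2,\ldots\}$ and $C,A_1,A_2,\ldots$ real, and let $\nu$ be a probability measure on $\mathbb R$ with characteristic function $\phi(\xi)=\int e^{i\xi x}\,\nu(dx)$. For a continuous $\psi:\mathbb R\to\{z\in\mathbb C:|z|\le 1\}$ put $$\widehat{\mathcal Q}\psi(\xi)=\mathbb E\Big[e^{i\xi C}\prod_{k=1}^{N}\psi(A_k\xi)\Big],\qquad \xi\in\mathbb R .$$ *Branching random walk.* Attach to the finite words $x$ over $\mathbb N=\{1,2,\ldots\}$ i.i.d. marks $(E(x),R(x),N(x),C(x),Z_1(x),Z_2(x),\ldots)$, where $E(x)$ is exponential with mean $1$, $R(x)$ has law $\nu$, $(N(x),C(x),(Z_k(x))_k)$ is distributed as $(N,C,(\log A_k)_k)$, and these three are independent. (Only $A_1,\ldots,A_N$, which are a.s. positive by (ii) below, play a role; the value of $\log$ at non-positive arguments is irrelevant.) Let $\mathcal T_\infty$ be the set of words $x=x_1\cdots x_n$, $n\ge 0$, with $x_k\le N(x_{|k-1})$ for $1\le k\le n$, where $x_{|k}=x_1\cdots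 x_k$ and $x_{|0}=\varnothing$. For $x\in\mathcal T_\infty$ of length $|x|$ let $$B(x)=\sum_{k=0}^{|x|-1}E(x_{|k}),\qquad D(x)=B(x)+E(x),\qquad V(x)=\sum_{k=1}^{|x|}Z_{x_k}(x_{|k-1}),$$ and for $t\ge0$ let $\partial\mathcal T_t=\{x\in\mathcal T_\infty:B(x)\le t<D(x)\}$ and $\mathcal T_t^{o}=\{x\in\mathcal T_\infty:D(x)\le t\}$. Define the point process $$\mathcal W_t=\sum_{x\in\partial\mathcal T_t}\delta_{(V(x),R(x))}+\sum_{x\in\mathcal T_t^{o}}\delta_{(V(x),C(x))}$$ on $\mathbb R^2$, and $$W_t=\int e^{v}z\,\mathcal W_t(dv,dz)=\sum_{x\in\partial\mathcal T_t}e^{V(x)}R(x)+\sum_{x\in\mathcal T_t^{o}}e^{V(x)}C(x).$$ **Theorem 2.1.** Assume that (i) $\displaystyle\int_{1-\varepsilon}^1\frac{ds}{s-\mathbb E[s^N]}=\infty$ for all sufficiently small $\varepsilon>0$; (ii) $\mathbb P[A_1>0,\ldots,A_m>0\mid N=m]=1$ for every $m$ with $\mathbb P[N=m]>0$; (iii)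 $\mathbb P[A_1=1,\ldots,A_m=1\mid N=m]<1$ for some $m$ with $\mathbb P[N=m]>0$; (iv) $\mathbb E[N]\in(1,\infty]$. Then, among the functions $(t,\xi)\mapsto\phi_t(\xi)$, $[0,\infty)\times\mathbb R\to\mathbb C$, such that $\phi_t$ is the characteristic function of a probability measure on $\mathbb R$ for every $t\ge0$ and $t\mapsto\phi_t(\xi)$ is $C^1$ on $[0,\infty)$ for every $\xi\in\mathbb R$, there is exactly one solution of $$\partial_t\phi_t(\xi)=\widehat{\mathcal Q}\phi_t(\xi)-\phi_t(\xi)\quad(t\ge 0,\ \xi\in\mathbb R),\qquad \phi_0=\phi .$$ Moreover, for every $t\ge0$, the sets $\partial\mathcal T_t$ and $\mathcal T^{o}_t$ are a.s. finite (so that $W_t$ is a.s. well defined), and the solution is given by $$\phi_t(\xi)=\mathbb E\exp\{i\xi W_t\},\qquad t\ge0,\ \xi\in\mathbb R .$$ -/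

import Mathlib

open MeasureTheory ProbabilityTheory Set Filter Topology

namespace Kinetic

/-! Indices are shifted by one throughout: `A k`, `Z k` for `k = 0, 1, 2, …` stand for
`A_{k+1}`, `Z_{k+1}`, and the children of a vertex `x` are `x0, x1, …, x(N(x)-1)`. -/

section Equation

variable {Ω₀ : Type*} [MeasurableSpace Ω₀]

/-- The classical non-explosion condition on the law of `N`:
`∫_{1-ε}^1 ds / (s - E[s^N]) = ∞` for all sufficiently small `ε > 0`. -/
def NonExplosion (P : Measure Ω₀) (N : Ω₀ → ℕ) : Prop :=
  ∀ᶠ ε in 𝓝[>] (0 : ℝ),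
    ∫⁻ s in Ioo (1 - ε) 1, ENNReal.ofReal (1 / (s - ∫ ω, s ^ N ω ∂P)) = ⊤

/-- Given `N = m`, the weights `A_1, …, A_m` are almost surely positive
(for every `m` with `P[N = m] > 0`). -/
def PositiveWeights (P : Measure Ω₀) (N : Ω₀ → ℕ) (A : ℕ → Ω₀ → ℝ) : Prop :=
  ∀ m : ℕ, 0 < P {ω | N ω = m} →
    (P[|{ω | N ω = m}]) {ω | ∀ k < m, 0 < A k ω} = 1

/-- The weights are not degenerate at `1`: for some `m` with `P[N = m] > 0`,
`P[A_1 = 1, …, A_m = 1 | N = m] < 1`. -/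
def NondegenerateWeights (P : Measure Ω₀) (N : Ω₀ → ℕ) (A : ℕ → Ω₀ → ℝ) : Prop :=
  ∃ m : ℕ, 0 < P {ω | N ω = m} ∧
    (P[|{ω | N ω = m}]) {ω | ∀ k < m, A k ω = 1} < 1

/-- `E[N] ∈ (1, ∞]`. -/
def Supercritical (P : Measure Ω₀) (N : Ω₀ → ℕ) : Prop :=
  1 < ∫⁻ ω, (N ω : ENNReal) ∂P

/-- The smoothing operator on the Fourier side,
`Q̂ψ(ξ) = E[exp(iξC) ∏_{k=1}^N ψ(A_k ξ)]`. -/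
noncomputable def smoothing (P : Measure Ω₀) (N : Ω₀ → ℕ) (C : Ω₀ → ℝ) (A : ℕ → Ω₀ → ℝ)
    (ψ : ℝ → ℂ) (ξ : ℝ) : ℂ :=
  ∫ ω, Complex.exp (Complex.I * ξ * C ω) * ∏ k ∈ Finset.range (N ω), ψ (A k ω * ξ) ∂P

/-- The class in which the equation is solved: each `φ(t, ·)`, `t ≥ 0`, is the characteristic
function of a probability measure on `ℝ`, and each `φ(·, ξ)` is `C^1` on `[0, ∞)`.
Values at negative times are irrelevant. -/
def SolutionClass (φ : ℝ → ℝ → ℂ) : Prop :=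
  (∀ t, 0 ≤ t → ∃ μ : Measure ℝ, IsProbabilityMeasure μ ∧ ∀ ξ, φ t ξ = charFun μ ξ) ∧
  ∀ ξ, ContDiffOn ℝ 1 (fun t => φ t ξ) (Ici 0)

/-- `∂_t φ_t(ξ) = Q̂φ_t(ξ) - φ_t(ξ)` for all `t ≥ 0` (one-sided at `t = 0`) and `ξ ∈ ℝ`,
with initial value the characteristic function of `ν`. -/
def SolvesKineticEquation (P : Measure Ω₀) (N : Ω₀ → ℕ) (C : Ω₀ → ℝ) (A : ℕ → Ω₀ → ℝ)
    (ν : Measure ℝ) (φ : ℝ → ℝ → ℂ) : Prop :=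
  (∀ t, 0 ≤ t → ∀ ξ,
    HasDerivWithinAt (fun s => φ s ξ) (smoothing P N C A (φ t) ξ - φ t ξ) (Ici 0) t) ∧
  ∀ ξ, φ 0 ξ = charFun ν ξ

end Equation

section BranchingRandomWalk

/-- The marks of a vertex: `(E, U, N, C, (Z_k)_k)`. -/
abbrev Mark : Type := ℝ × ℝ × ℕ × ℝ × (ℕ → ℝ)

namespace Mark

/-- The lifetime `E(x)`. -/
def E (a : Mark) : ℝ := a.1

/-- The independent mark `U(x)`. -/
def U (a : Mark) : ℝ := a.2.1

/-- The number of children `N(x)`. -/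
def N (a : Mark) : ℕ := a.2.2.1

/-- The shift `C(x)`. -/
def C (a : Mark) : ℝ := a.2.2.2.1

/-- The displacements `Z_k(x)`. -/
def Z (a : Mark) : ℕ → ℝ := a.2.2.2.2

end Mark

/-- A configuration of marks on the Ulam-Harris labels (finite words, the root being the empty
word; the first letter is the index of the ancestor in the first generation). -/
abbrev Config : Type := List ℕ → Mark

namespace Config

variable (m : Config)

/-- The Galton-Watson tree `𝒯_∞`. -/
def tree : Set (List ℕ) := {x | ∀ k : Fin x.length, x.get k < (m (x.take k)).N}

/-- The birth time `B(x) = ∑_{k=0}^{|x|-1} E(x_{|k})`. -/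
noncomputable def birth (x : List ℕ) : ℝ := ∑ k ∈ Finset.range x.length, (m (x.take k)).E

/-- The death time `D(x) = B(x) + E(x)`. -/
noncomputable def death (x : List ℕ) : ℝ := m.birth x + (m x).E

/-- The position `V(x)`: the sum of the displacements along the path from the root to `x`. -/
noncomputable def position (x : List ℕ) : ℝ :=
  ∑ k : Fin x.length, (m (x.take k)).Z (x.get k)

/-- The particles alive at time `t`. -/
def alive (t : ℝ) : Set (List ℕ) := {x | x ∈ m.tree ∧ m.birth x ≤ t ∧ t < m.death x}

/-- The particles removed from the system by time `t`. -/
def dead (t : ℝ) : Set (List ℕ) := {x | x ∈ m.tree ∧ m.death x ≤ t}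

/-- The point process `𝒳_{U,t} = ∑_{x alive at t} δ_{V(x)} ⊗ δ_{U(x)}`. -/
noncomputable def alivePoints (t : ℝ) : Measure (ℝ × ℝ) :=
  Measure.sum fun x : m.alive t => Measure.dirac (m.position x, (m x).U)

/-- The point process `𝒞_t = ∑_{x dead by t} δ_{V(x)} ⊗ δ_{C(x)}`. -/
noncomputable def deadPoints (t : ℝ) : Measure (ℝ × ℝ) :=
  Measure.sum fun x : m.dead t => Measure.dirac (m.position x, (m x).C)

/-- `𝒲_t = 𝒳_{U,t} + 𝒞_t`. -/
noncomputable def allPoints (t : ℝ) : Measure (ℝ × ℝ) := m.alivePoints t + m.deadPoints t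

/-- `W_t = ∫ e^v z 𝒲_t(dv, dz)`. -/
noncomputable def W (t : ℝ) : ℝ := ∫ p, Real.exp p.1 * p.2 ∂(m.allPoints t)

end Config

/-- The law of the marks of one vertex: `E` is exponential with mean one, `U` has law `ν`,
`(N, C, (Z_k)_k)` is distributed as `(N, C, (log A_k)_k)`, and these three are independent. -/
noncomputable def markLaw {Ω₀ : Type*} [MeasurableSpace Ω₀]
    (P : Measure Ω₀) (N : Ω₀ → ℕ) (C : Ω₀ → ℝ) (A : ℕ → Ω₀ → ℝ) (ν : Measure ℝ) : Measure Mark :=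
  (expMeasure 1).prod
    (ν.prod (P.map fun ω => (N ω, C ω, fun k => Real.log (A k ω))))

/-- The random configuration `M` is a family of i.i.d. marks with common law `law`. -/
structure IsIIDConfig {Ω : Type*} [MeasurableSpace Ω] (Pr : Measure Ω) (law : Measure Mark)
    (M : Ω → Config) : Prop where
  measurable : ∀ x, Measurable fun ω => M ω x
  indep : iIndepFun (fun x ω => M ω x) Pr
  law_eq : ∀ x, Pr.map (fun ω => M ω x) = law

end BranchingRandomWalk

end Kinetic

/-!
The solution is `φ_t(ξ) = E exp(iξW_t)`, computed under the law of an i.i.d. configuration of marks.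

If the root outlives `t` then `W_t` is its mark `U`; otherwise
`W_t = C + ∑_{k<N} e^{Z_k} W_{t-E}(k)`, where `W(k)` is computed in the subtree of the `k`-th child.
The subtrees are independent copies of the whole configuration (`Config.map_graft`). So if `S'` and
`S` are families of events such that `S'` at time `t` means that the root outlives `t` or that `S`
holds in all its subtrees for the remaining time (`BranchingEvents`), then
`F_t(ξ) = E[exp(iξW_t); S_t]` and the analogous `F'` satisfy the renewal equation
`e^t F'_t = φ_0 + ∫_0^t e^u Q̂F_u du` (`renewal_meanPhase`). It is used three times.

* Let `S = S'` be the event that only finitely many generations are reached by time `t`; vertices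
  have finitely many children, so only finitely many particles are then born by time `t`. The
  renewal equation is the integrated kinetic equation (`hasDerivWithinAt_meanPhase`).
* At `ξ = 0` the same equation says that the probability `h` of this event solves `h' = f(h) - h`,
  `h(0) = 1`, with `f` the generating function of `N`. Since `E[N] > 1`, `f` lies below the diagonal
  near `1` (`Supercritical.exists_lt`), and the divergence of `∫ ds / (s - f(s))` forces `h = 1`
  (`eq_one_of_osgood`). So `W_t` is a finite sum almost surely and `F_t` is its characteristic
  function.
* For uniqueness, let `S_n` be the event that only generations below `n` are reached, with
  probability `h_n`; the renewal equation applies to `S = S_n`, `S' = S_{n+1}`. By induction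
  on `n`, every solution is within `1 - h_n(t)` of `E[exp(iξW_t); S_n]`
  (`norm_sub_meanPhase_depthLT_le`): if `|a_k| ≤ 1`, `|b_k| ≤ h` and
  `|a_k - b_k| ≤ 1 - h`, then the products over `k < N` differ by at most `1 - h^N`, so that
  no moment of `N` is needed. As `h_n → h = 1`, the solution is determined.
-/

namespace Kinetic

/-! ### The branching at the root -/

namespace Config

/-- The configuration seen from the `k`-th child of the root. -/
def child (m : Config) (k : ℕ) : Config := fun x => m (k :: x)

/-- The configuration with root mark `a` whose `k`-th subtree carries the configuration `c k`. -/
def graft (a : Mark) (c : ℕ → Config) : Config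
  | [] => a
  | k :: x => c k x

lemma nil_mem_tree (m : Config) : [] ∈ m.tree := fun k => k.elim0

lemma cons_mem_tree {m : Config} {k : ℕ} {x : List ℕ} :
    k :: x ∈ m.tree ↔ k < (m []).N ∧ x ∈ (m.child k).tree := by
  simp only [tree, mem_ofPred_eq, child]
  exact Fin.forall_fin_succ (n := x.length)

@[simp] lemma birth_nil (m : Config) : m.birth [] = 0 := by simp [birth]

lemma birth_cons (m : Config) (k : ℕ) (x : List ℕ) :
    m.birth (k :: x) = (m []).E + (m.child k).birth x := by
  simp only [birth, List.length_cons, Finset.sum_range_succ', child, List.take_succ_cons,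
    List.take_zero]
  ring

lemma death_nil (m : Config) : m.death [] = (m []).E := by simp [death]

lemma death_cons (m : Config) (k : ℕ) (x : List ℕ) :
    m.death (k :: x) = (m []).E + (m.child k).death x := by
  simp only [death, birth_cons, child]
  ring

lemma position_nil (m : Config) : m.position [] = 0 := by simp [position]

lemma position_cons (m : Config) (k : ℕ) (x : List ℕ) :
    m.position (k :: x) = (m []).Z k + (m.child k).position x :=
  Fin.sum_univ_succ (n := x.length) (fun i : Fin (x.length + 1) =>
    (m ((k :: x).take i)).Z ((k :: x).get i))

/-- Configurations without negative lifetimes; almost every configuration is one. -/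
def nonnegLifetimes : Set Config := {m | ∀ x, 0 ≤ (m x).E}

lemma child_mem_nonnegLifetimes {m : Config} (hm : m ∈ nonnegLifetimes) (k : ℕ) :
    m.child k ∈ nonnegLifetimes := fun x => hm (k :: x)

lemma birth_nonneg {m : Config} (hm : m ∈ nonnegLifetimes) (x : List ℕ) : 0 ≤ m.birth x :=
  Finset.sum_nonneg fun _ _ => hm _

lemma birth_le_death {m : Config} (hm : m ∈ nonnegLifetimes) (x : List ℕ) :
    m.birth x ≤ m.death x := le_add_of_nonneg_right (hm x)

/-- The particles born by time `t`, whether still alive or not. -/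
def born (m : Config) (t : ℝ) : Set (List ℕ) := {x | x ∈ m.tree ∧ m.birth x ≤ t}

/-- Configurations in which every particle born by time `t` has generation less than `n`. -/
def depthLT (n : ℕ) (t : ℝ) : Set Config := {m | ∀ x ∈ m.born t, x.length < n}

/-- Configurations in which only finitely many generations are reached by time `t`. -/
def nonexplosive (t : ℝ) : Set Config := ⋃ n, depthLT n t

lemma depthLT_mono (t : ℝ) : Monotone fun n => depthLT n t :=
  fun _ _ h _ hm x hx => (hm x hx).trans_le h

lemma depthLT_zero {t : ℝ} (ht : 0 ≤ t) : depthLT 0 t = ∅ := by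
  ext m
  simp only [depthLT, mem_ofPred_eq, mem_empty_iff_false, iff_false]
  intro h
  exact absurd (h [] ⟨nil_mem_tree m, by simpa using ht⟩) (by simp)

lemma cons_mem_born {m : Config} {t : ℝ} {k : ℕ} {x : List ℕ} :
    k :: x ∈ m.born t ↔ k < (m []).N ∧ x ∈ (m.child k).born (t - (m []).E) := by
  simp only [born, mem_ofPred_eq, cons_mem_tree, birth_cons, and_assoc, le_sub_iff_add_le']

lemma cons_notMem_born {m : Config} (hm : m ∈ nonnegLifetimes) {t : ℝ} (h : t < (m []).E)
    (k : ℕ) (x : List ℕ) : k :: x ∉ m.born t := by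
  intro hx
  have := birth_nonneg (child_mem_nonnegLifetimes hm k) x
  have h2 := hx.2
  rw [birth_cons] at h2
  linarith

lemma mem_depthLT_succ {m : Config} (hm : m ∈ nonnegLifetimes) (n : ℕ) (t : ℝ) :
    m ∈ depthLT (n + 1) t ↔
      t < (m []).E ∨ ∀ k < (m []).N, m.child k ∈ depthLT n (t - (m []).E) := by
  constructor
  · intro h
    refine or_iff_not_imp_left.2 fun _ k hk x hx => ?_
    simpa using h (k :: x) (cons_mem_born.2 ⟨hk, hx⟩)
  · rintro (h | h) (_ | ⟨k, x⟩) hx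
    · simp
    · exact absurd hx (cons_notMem_born hm h k x)
    · simp
    · have := cons_mem_born.1 hx
      simpa using h k this.1 x this.2

lemma mem_nonexplosive {m : Config} (hm : m ∈ nonnegLifetimes) (t : ℝ) :
    m ∈ nonexplosive t ↔
      t < (m []).E ∨ ∀ k < (m []).N, m.child k ∈ nonexplosive (t - (m []).E) := by
  simp only [nonexplosive, mem_iUnion]
  constructor
  · rintro ⟨n, hn⟩
    have hn' := (mem_depthLT_succ hm n t).1 (depthLT_mono t n.le_succ hn)
    exact hn'.imp id fun h k hk => ⟨n, h k hk⟩
  · rintro (h | h)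
    · exact ⟨1, (mem_depthLT_succ hm 0 t).2 (Or.inl h)⟩
    · choose! f hf using h
      refine ⟨(Finset.range (m []).N).sup f + 1, (mem_depthLT_succ hm _ t).2 (Or.inr ?_)⟩
      intro k hk
      exact depthLT_mono _ (Finset.le_sup (f := f) (Finset.mem_range.2 hk)) (hf k hk)

/-- Each vertex has finitely many children, so finitely many generations hold finitely many
vertices. -/
lemma finite_tree_length_lt (n : ℕ) (m : Config) : {x | x ∈ m.tree ∧ x.length < n}.Finite := by
  induction n generalizing m with
  | zero => simp
  | succ n ih =>
    refine (((Finset.range (m []).N).finite_toSet.biUnion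
      fun k _ => (ih (m.child k)).image (List.cons k)).insert []).subset ?_
    rintro (_ | ⟨k, x⟩) ⟨hx, hl⟩
    · simp
    · have := cons_mem_tree.1 hx
      refine mem_insert_of_mem _ (mem_biUnion (x := k) (by simpa using this.1) ?_)
      exact mem_image_of_mem _ ⟨this.2, by simpa using hl⟩

lemma finite_born {m : Config} {t : ℝ} (h : m ∈ nonexplosive t) : (m.born t).Finite := by
  obtain ⟨n, hn⟩ := mem_iUnion.1 h
  exact (finite_tree_length_lt n m).subset fun x hx => ⟨hx.1, hn x hx⟩

lemma alive_subset_born (m : Config) (t : ℝ) : m.alive t ⊆ m.born t := fun _ h => ⟨h.1, h.2.1⟩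

lemma dead_subset_born {m : Config} (hm : m ∈ nonnegLifetimes) (t : ℝ) : m.dead t ⊆ m.born t :=
  fun x h => ⟨h.1, (birth_le_death hm x).trans h.2⟩

lemma finite_alive {m : Config} {t : ℝ} (h : m ∈ nonexplosive t) : (m.alive t).Finite :=
  (finite_born h).subset (alive_subset_born m t)

lemma finite_dead {m : Config} (hm : m ∈ nonnegLifetimes) {t : ℝ} (h : m ∈ nonexplosive t) :
    (m.dead t).Finite :=
  (finite_born h).subset (dead_subset_born hm t)

lemma cons_mem_alive {m : Config} {t : ℝ} {k : ℕ} {x : List ℕ} :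
    k :: x ∈ m.alive t ↔ k < (m []).N ∧ x ∈ (m.child k).alive (t - (m []).E) := by
  simp only [alive, mem_ofPred_eq, cons_mem_tree, birth_cons, death_cons, and_assoc,
    le_sub_iff_add_le', sub_lt_iff_lt_add']

lemma cons_mem_dead {m : Config} {t : ℝ} {k : ℕ} {x : List ℕ} :
    k :: x ∈ m.dead t ↔ k < (m []).N ∧ x ∈ (m.child k).dead (t - (m []).E) := by
  simp only [dead, mem_ofPred_eq, cons_mem_tree, death_cons, and_assoc, le_sub_iff_add_le']

lemma alive_of_lt {m : Config} (hm : m ∈ nonnegLifetimes) {t : ℝ} (ht : 0 ≤ t)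
    (h : t < (m []).E) : m.alive t = {[]} := by
  ext (_ | ⟨k, x⟩)
  · simp [alive, nil_mem_tree, death_nil, h, ht]
  · simpa using fun hx => cons_notMem_born hm h k x (alive_subset_born m t hx)

lemma dead_of_lt {m : Config} (hm : m ∈ nonnegLifetimes) {t : ℝ}
    (h : t < (m []).E) : m.dead t = ∅ := by
  ext (_ | ⟨k, x⟩)
  · simp [dead, death_nil, h]
  · simpa using fun hx => cons_notMem_born hm h k x (dead_subset_born hm t hx)

lemma alive_of_le {m : Config} {t : ℝ} (h : (m []).E ≤ t) :
    m.alive t = ⋃ k ∈ Iio (m []).N, List.cons k '' (m.child k).alive (t - (m []).E) := by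
  ext (_ | ⟨k, x⟩)
  · simp [alive, death_nil, h]
  · simp [cons_mem_alive, and_comm]

lemma dead_of_le {m : Config} {t : ℝ} (h : (m []).E ≤ t) :
    m.dead t =
      insert [] (⋃ k ∈ Iio (m []).N, List.cons k '' (m.child k).dead (t - (m []).E)) := by
  ext (_ | ⟨k, x⟩)
  · simp [dead, death_nil, h, nil_mem_tree]
  · simp [cons_mem_dead, and_comm]

end Config

lemma pairwiseDisjoint_cons_image (I : Set ℕ) (s : ℕ → Set (List ℕ)) :
    I.PairwiseDisjoint fun k => List.cons k '' s k := by
  intro i _ j _ hij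
  rw [Function.onFun, Set.disjoint_left]
  rintro _ ⟨x, _, rfl⟩ ⟨y, _, h⟩
  exact hij (List.cons.inj h).1.symm

lemma finsum_mem_biUnion_cons (n : ℕ) (s : ℕ → Set (List ℕ)) (hs : ∀ k < n, (s k).Finite)
    (f : List ℕ → ℝ) :
    ∑ᶠ x ∈ ⋃ k ∈ Iio n, List.cons k '' s k, f x =
      ∑ k ∈ Finset.range n, ∑ᶠ x ∈ s k, f (k :: x) := by
  rw [finsum_mem_biUnion (pairwiseDisjoint_cons_image _ _) (finite_Iio n)
    fun k hk => (hs k hk).image _]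
  rw [← Finset.coe_Iio, finsum_mem_coe_finset, Nat.Iio_eq_range]
  exact Finset.sum_congr rfl fun k _ => finsum_mem_image (List.cons_injective.injOn)

namespace Config

lemma integrable_and_integral_sum_dirac (m : Config) {s : Set (List ℕ)}
    (hs : s.Finite) (g : List ℕ → ℝ) :
    Integrable (fun p : ℝ × ℝ => Real.exp p.1 * p.2)
        (Measure.sum fun x : s => Measure.dirac (m.position x, g x)) ∧
      ∫ p, Real.exp p.1 * p.2 ∂(Measure.sum fun x : s => Measure.dirac (m.position x, g x)) =
        ∑ᶠ x ∈ s, Real.exp (m.position x) * g x := by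
  have := hs.fintype
  have hi : ∀ x ∈ (Finset.univ : Finset s), Integrable (fun p : ℝ × ℝ => Real.exp p.1 * p.2)
      (Measure.dirac (m.position x, g x)) := fun x _ =>
    integrable_dirac enorm_lt_top
  rw [Measure.sum_fintype]
  refine ⟨integrable_finsetSum_measure.2 hi, ?_⟩
  rw [integral_finsetSum_measure hi, finsum_mem_eq_finite_toFinset_sum _ hs]
  simp only [integral_dirac]
  exact (Finset.sum_subtype hs.toFinset (fun x => hs.mem_toFinset)
    fun x => Real.exp (m.position x) * g x).symm

lemma integrable_allPoints {m : Config} (hm : m ∈ nonnegLifetimes) {t : ℝ}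
    (h : m ∈ nonexplosive t) :
    Integrable (fun p : ℝ × ℝ => Real.exp p.1 * p.2) (m.allPoints t) :=
  (integrable_and_integral_sum_dirac m (finite_alive h) fun x => (m x).U).1.add_measure
    (integrable_and_integral_sum_dirac m (finite_dead hm h) fun x => (m x).C).1

lemma W_eq_finsum {m : Config} (hm : m ∈ nonnegLifetimes) {t : ℝ} (h : m ∈ nonexplosive t) :
    m.W t = ∑ᶠ x ∈ m.alive t, Real.exp (m.position x) * (m x).U +
      ∑ᶠ x ∈ m.dead t, Real.exp (m.position x) * (m x).C := by
  have ha := integrable_and_integral_sum_dirac m (finite_alive h) fun x => (m x).U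
  have hd := integrable_and_integral_sum_dirac m (finite_dead hm h) fun x => (m x).C
  rw [W, allPoints, alivePoints, deadPoints, integral_add_measure ha.1 hd.1, ha.2, hd.2]

lemma W_of_lt {m : Config} (hm : m ∈ nonnegLifetimes) {t : ℝ} (ht : 0 ≤ t)
    (h : t < (m []).E) : m.W t = (m []).U := by
  rw [W_eq_finsum hm ((mem_nonexplosive hm t).2 (Or.inl h)), alive_of_lt hm ht h, dead_of_lt hm h,
    finsum_mem_singleton, finsum_mem_empty]
  simp [position_nil]

/-- If the root dies by time `t`, then `W_t` is the shift of the root plus the weighted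
contributions of its children, run for the remaining time. -/
lemma W_of_le {m : Config} (hm : m ∈ nonnegLifetimes) {t : ℝ} (h : (m []).E ≤ t)
    (hf : ∀ k < (m []).N, m.child k ∈ nonexplosive (t - (m []).E)) :
    m.W t = (m []).C + ∑ k ∈ Finset.range (m []).N,
      Real.exp ((m []).Z k) * (m.child k).W (t - (m []).E) := by
  have hd : ∀ k < (m []).N, ((m.child k).dead (t - (m []).E)).Finite := fun k hk =>
    finite_dead (child_mem_nonnegLifetimes hm k) (hf k hk)
  have ha : ∀ k < (m []).N, ((m.child k).alive (t - (m []).E)).Finite := fun k hk =>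
    finite_alive (hf k hk)
  rw [W_eq_finsum hm ((mem_nonexplosive hm t).2 (Or.inr hf)), alive_of_le h, dead_of_le h,
    finsum_mem_insert _ (by simp)
      ((finite_Iio _).biUnion fun k hk => (hd k hk).image (List.cons k)),
    finsum_mem_biUnion_cons _ _ ha, finsum_mem_biUnion_cons _ _ hd, add_left_comm,
    ← Finset.sum_add_distrib, position_nil, Real.exp_zero, one_mul]
  congr 1
  refine Finset.sum_congr rfl fun k hk => ?_
  have hk' := Finset.mem_range.1 hk
  rw [W_eq_finsum (child_mem_nonnegLifetimes hm k) (hf k hk'), mul_add,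
    mul_finsum_mem' _ _ (ha k hk'), mul_finsum_mem' _ _ (hd k hk')]
  simp only [position_cons, Real.exp_add, child, mul_assoc]

end Config

/-! ### Law and measurability of the configuration -/

namespace Mark

@[fun_prop] lemma measurable_E : Measurable E := measurable_fst
@[fun_prop] lemma measurable_U : Measurable U := measurable_fst.comp measurable_snd
@[fun_prop] lemma measurable_N : Measurable N :=
  measurable_fst.comp (measurable_snd.comp measurable_snd)
@[fun_prop] lemma measurable_C : Measurable C :=
  measurable_fst.comp (measurable_snd.comp (measurable_snd.comp measurable_snd))
@[fun_prop] lemma measurable_Z (k : ℕ) : Measurable fun a : Mark => a.Z k :=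
  (measurable_pi_apply k).comp
    (measurable_snd.comp (measurable_snd.comp (measurable_snd.comp measurable_snd)))

end Mark

namespace Config

lemma measurable_graft : Measurable fun p : Mark × (ℕ → Config) => graft p.1 p.2 := by
  refine measurable_pi_iff.2 ?_
  rintro (_ | ⟨k, x⟩)
  · exact measurable_fst
  · exact (measurable_pi_apply x).comp ((measurable_pi_apply k).comp measurable_snd)

/-- The root mark and the subtrees at the children of the root of an i.i.d. configuration are
independent, and every subtree is distributed as the whole configuration. -/
lemma map_graft (law : Measure Mark) [IsProbabilityMeasure law] :
    (law.prod (Measure.infinitePi fun _ : ℕ => Measure.infinitePi fun _ : List ℕ => law)).map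
      (fun p => graft p.1 p.2) = Measure.infinitePi fun _ : List ℕ => law := by
  classical
  refine Measure.eq_infinitePi _ fun s t ht => ?_
  -- Enlarge the finite index set `s` to one of the form `{∅} ∪ K·S`, with trivial constraints
  -- on the added words.
  let t' : List ℕ → Set Mark := fun x => if x ∈ s then t x else univ
  have ht' : ∀ x, MeasurableSet (t' x) := fun x => by
    by_cases hx : x ∈ s <;> simp [t', hx, ht]
  let K : Finset ℕ := s.image List.headI
  let S : Finset (List ℕ) := s.image List.tail
  have hpre : (fun p : Mark × (ℕ → Config) => graft p.1 p.2) ⁻¹' (s : Set (List ℕ)).pi t =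
      t' [] ×ˢ (K : Set ℕ).pi fun k => (S : Set (List ℕ)).pi fun y => t' (k :: y) := by
    ext ⟨a, c⟩
    simp only [mem_preimage, Set.mem_pi, mem_prod, Finset.mem_coe, t']
    constructor
    · intro h
      refine ⟨?_, fun k _ y _ => ?_⟩
      · by_cases h0 : [] ∈ s
        · simpa [h0, graft] using h [] h0
        · simp [h0]
      · by_cases h0 : k :: y ∈ s
        · simpa [h0, graft] using h (k :: y) h0
        · simp [h0]
    · rintro ⟨h0, h1⟩ (_ | ⟨k, y⟩) hx
      · simpa [hx, graft] using h0
      · have := h1 k (Finset.mem_image.2 ⟨_, hx, rfl⟩) y (Finset.mem_image.2 ⟨_, hx, rfl⟩)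
        simpa [hx, graft] using this
  have hbig : ∏ x ∈ s, law (t x) =
      law (t' []) * ∏ k ∈ K, ∏ y ∈ S, law (t' (k :: y)) := by
    let T : Finset (List ℕ) := insert [] ((K ×ˢ S).image fun p => p.1 :: p.2)
    have hsT : s ⊆ T := by
      rintro (_ | ⟨k, y⟩) hx
      · simp [T]
      · refine Finset.mem_insert_of_mem (Finset.mem_image.2 ⟨(k, y), ?_, rfl⟩)
        exact Finset.mem_product.2
          ⟨Finset.mem_image.2 ⟨_, hx, rfl⟩, Finset.mem_image.2 ⟨_, hx, rfl⟩⟩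
    have h1 : ∏ x ∈ s, law (t x) = ∏ x ∈ T, law (t' x) := by
      rw [← Finset.prod_subset hsT fun x _ hx => by simp [t', hx]]
      exact Finset.prod_congr rfl fun x hx => by simp [t', hx]
    rw [h1, Finset.prod_insert (by simp), Finset.prod_image, Finset.prod_product]
    rintro ⟨_, _⟩ _ ⟨_, _⟩ _ h
    simpa using h
  have hms : MeasurableSet ((s : Set (List ℕ)).pi t) :=
    MeasurableSet.pi s.countable_toSet fun x _ => ht x
  rw [Measure.map_apply measurable_graft hms, hpre, Measure.prod_prod, hbig,
    Measure.infinitePi_pi _ fun k _ => MeasurableSet.pi S.countable_toSet fun y _ => ht' _]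
  congr 1
  refine Finset.prod_congr rfl fun k _ => ?_
  exact Measure.infinitePi_pi (μ := fun _ : List ℕ => law) fun y _ => ht' _

@[fun_prop] lemma measurable_birth (x : List ℕ) : Measurable fun m : Config => m.birth x := by
  unfold birth; fun_prop

@[fun_prop] lemma measurable_death (x : List ℕ) : Measurable fun m : Config => m.death x := by
  unfold death; fun_prop

@[fun_prop] lemma measurable_position (x : List ℕ) :
    Measurable fun m : Config => m.position x := by
  refine Finset.measurable_fun_sum _ fun k _ => ?_
  exact (Mark.measurable_Z _).comp (measurable_pi_apply _)

lemma measurableSet_mem_tree (x : List ℕ) : MeasurableSet {m : Config | x ∈ m.tree} := by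
  have : {m : Config | x ∈ m.tree} =
      ⋂ k : Fin x.length, {m : Config | x.get k < (m (x.take k)).N} := by
    ext m
    simp [tree]
  rw [this]
  exact MeasurableSet.iInter fun k => measurableSet_lt measurable_const (by fun_prop)

lemma measurableSet_mem_born (x : List ℕ) (t : ℝ) : MeasurableSet {m : Config | x ∈ m.born t} :=
  (measurableSet_mem_tree x).inter (measurableSet_le (measurable_birth x) measurable_const)

lemma measurableSet_mem_alive (x : List ℕ) (t : ℝ) :
    MeasurableSet {m : Config | x ∈ m.alive t} :=
  (measurableSet_mem_tree x).inter ((measurableSet_le (measurable_birth x) measurable_const).inter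
    (measurableSet_lt measurable_const (measurable_death x)))

lemma measurableSet_mem_dead (x : List ℕ) (t : ℝ) :
    MeasurableSet {m : Config | x ∈ m.dead t} :=
  (measurableSet_mem_tree x).inter (measurableSet_le (measurable_death x) measurable_const)

lemma measurableSet_depthLT (n : ℕ) (t : ℝ) : MeasurableSet (depthLT n t) := by
  have : depthLT n t = ⋂ x : List ℕ, {m : Config | x ∈ m.born t}ᶜ ∪ {_m | x.length < n} := by
    ext m
    simp [depthLT, imp_iff_not_or]
  rw [this]
  exact MeasurableSet.iInter fun x =>
    (measurableSet_mem_born x t).compl.union (MeasurableSet.const _)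

lemma measurableSet_nonexplosive (t : ℝ) : MeasurableSet (nonexplosive t) :=
  MeasurableSet.iUnion fun n => measurableSet_depthLT n t

lemma measurableSet_nonnegLifetimes : MeasurableSet nonnegLifetimes := by
  have : nonnegLifetimes = ⋂ x : List ℕ, {m : Config | 0 ≤ (m x).E} := by
    ext m
    simp [nonnegLifetimes]
  rw [this]
  exact MeasurableSet.iInter fun x => measurableSet_le measurable_const (by fun_prop)

lemma tendsto_sum_indicator {s : Set (List ℕ)} (hs : s.Finite) (f : List ℕ → ℝ) :
    Tendsto (fun T : Finset (List ℕ) => ∑ x ∈ T, s.indicator f x) atTop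
      (𝓝 (∑ᶠ x ∈ s, f x)) := by
  have h := hasSum_sum_of_ne_finset_zero (f := s.indicator f) (s := hs.toFinset)
    (L := SummationFilter.unconditional _) fun x hx =>
    indicator_of_notMem (by simpa using hx) _
  have h2 : ∑ x ∈ hs.toFinset, s.indicator f x = ∑ᶠ x ∈ s, f x := by
    rw [finsum_mem_eq_finite_toFinset_sum _ hs]
    exact Finset.sum_congr rfl fun x hx => indicator_of_mem (by simpa using hx) _
  rw [h2] at h
  simpa [HasSum] using h

/-- `W_t` is measurable on the nonexplosive configurations, as a limit of finite sums. -/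
lemma measurable_indicator_W (t : ℝ) :
    Measurable ((nonnegLifetimes ∩ nonexplosive t).indicator fun m => m.W t) := by
  refine measurable_of_tendsto_metrizable' (atTop : Filter (Finset (List ℕ)))
    (f := fun T => (nonnegLifetimes ∩ nonexplosive t).indicator fun m =>
      ∑ x ∈ T, (m.alive t).indicator (fun x => Real.exp (m.position x) * (m x).U) x +
      ∑ x ∈ T, (m.dead t).indicator (fun x => Real.exp (m.position x) * (m x).C) x)
    (fun T => ?_) (tendsto_pi_nhds.2 fun m => ?_)
  · refine Measurable.indicator (Measurable.add ?_ ?_)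
      (measurableSet_nonnegLifetimes.inter (measurableSet_nonexplosive t))
    · refine Finset.measurable_fun_sum _ fun x _ => ?_
      exact Measurable.indicator (f := fun m : Config => Real.exp (m.position x) * (m x).U)
        (by fun_prop) (measurableSet_mem_alive x t)
    · refine Finset.measurable_fun_sum _ fun x _ => ?_
      exact Measurable.indicator (f := fun m : Config => Real.exp (m.position x) * (m x).C)
        (by fun_prop) (measurableSet_mem_dead x t)
  · by_cases hm : m ∈ nonnegLifetimes ∩ nonexplosive t
    · simp only [indicator_of_mem hm]
      rw [W_eq_finsum hm.1 hm.2]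
      exact (tendsto_sum_indicator (finite_alive hm.2) _).add
        (tendsto_sum_indicator (finite_dead hm.1 hm.2) _)
    · simp only [indicator_of_notMem hm]
      exact tendsto_const_nhds

end Config

lemma integral_prod_range_infinitePi {X : Type*} [MeasurableSpace X] (μ : Measure X)
    [IsProbabilityMeasure μ] (n : ℕ) (g : ℕ → X → ℂ)
    (hg : ∀ k, AEStronglyMeasurable (g k) μ) :
    ∫ c, ∏ k ∈ Finset.range n, g k (c k) ∂(Measure.infinitePi fun _ : ℕ => μ) =
      ∏ k ∈ Finset.range n, ∫ x, g k x ∂μ := by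
  have h1 : ∀ c : ℕ → X, ∏ k ∈ Finset.range n, g k (c k) =
      (fun y : Finset.range n → X => ∏ k : Finset.range n, g k (y k))
        ((Finset.range n).restrict c) := fun c =>
    Finset.prod_subtype _ (fun _ => Iff.rfl) _
  refine (integral_congr_ae (ae_of_all _ h1)).trans
    ((integral_restrict_infinitePi (X := fun _ : ℕ => X) (μ := fun _ : ℕ => μ)
      (s := Finset.range n) (f := fun y => ∏ k : Finset.range n, g k (y k)) ?_).trans ?_)
  · refine Finset.aestronglyMeasurable_fun_prod _ fun k _ => ?_
    exact (hg k).comp_quasiMeasurePreserving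
      (measurePreserving_eval (fun _ : Finset.range n => μ) k).quasiMeasurePreserving
  · rw [integral_fintype_prod_eq_prod (fun (k : Finset.range n) x => g k x)]
    exact (Finset.prod_subtype _ (fun _ => Iff.rfl) fun k => ∫ x, g k x ∂μ).symm

/-! ### Averaging over the subtrees of the root -/

/-- The law of an i.i.d. configuration. -/
noncomputable def configLaw (law : Measure Mark) : Measure Config :=
  Measure.infinitePi fun _ : List ℕ => law

/-- A pair of families of events, indexed by time, that are related by the branching at the root:
`S' t` occurs if the root outlives `t`, or if `S` occurs in all subtrees for the remaining time. -/
structure BranchingEvents (S S' : ℝ → Set Config) : Prop where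
  measurable_left : ∀ t, MeasurableSet (S t)
  measurable_right : ∀ t, MeasurableSet (S' t)
  subset_left : ∀ t, S t ⊆ Config.nonexplosive t
  subset_right : ∀ t, S' t ⊆ Config.nonexplosive t
  mem_iff : ∀ m ∈ Config.nonnegLifetimes, ∀ t, m ∈ S' t ↔
    t < (m []).E ∨ ∀ k < (m []).N, m.child k ∈ S (t - (m []).E)

lemma branchingEvents_depthLT (n : ℕ) :
    BranchingEvents (Config.depthLT n) (Config.depthLT (n + 1)) where
  measurable_left := Config.measurableSet_depthLT n
  measurable_right := Config.measurableSet_depthLT (n + 1)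
  subset_left t := subset_iUnion (fun n => Config.depthLT n t) n
  subset_right t := subset_iUnion (fun n => Config.depthLT n t) (n + 1)
  mem_iff _ hm t := Config.mem_depthLT_succ hm n t

lemma branchingEvents_nonexplosive :
    BranchingEvents Config.nonexplosive Config.nonexplosive where
  measurable_left := Config.measurableSet_nonexplosive
  measurable_right := Config.measurableSet_nonexplosive
  subset_left _ := subset_rfl
  subset_right _ := subset_rfl
  mem_iff _ hm t := Config.mem_nonexplosive hm t

/-- The integrand `exp(iξW_t)`, restricted to the event `S t`. -/
noncomputable def phase (S : ℝ → Set Config) (t ξ : ℝ) (m : Config) : ℂ :=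
  (S t).indicator (fun m => Complex.exp (Complex.I * ξ * m.W t)) m

lemma norm_exp_I_mul (a b : ℝ) : ‖Complex.exp (Complex.I * a * b)‖ = 1 := by
  rw [mul_assoc, mul_comm, ← Complex.ofReal_mul, Complex.norm_exp_ofReal_mul_I]

lemma norm_phase (S : ℝ → Set Config) (t ξ : ℝ) (m : Config) :
    ‖phase S t ξ m‖ = (S t).indicator (fun _ => 1) m := by
  by_cases h : m ∈ S t <;> simp [phase, h, norm_exp_I_mul]

lemma norm_phase_le (S : ℝ → Set Config) (t ξ : ℝ) (m : Config) : ‖phase S t ξ m‖ ≤ 1 := by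
  rw [norm_phase]
  exact indicator_le_self' (fun _ _ => zero_le_one) m

/-- The branching property of `exp(iξW_t)` at the root. -/
lemma phase_branching {S S' : ℝ → Set Config} (hS : BranchingEvents S S') {m : Config}
    (hm : m ∈ Config.nonnegLifetimes) {t : ℝ} (ht : 0 ≤ t) (ξ : ℝ) :
    phase S' t ξ m = if t < (m []).E then Complex.exp (Complex.I * ξ * (m []).U) else
      Complex.exp (Complex.I * ξ * (m []).C) * ∏ k ∈ Finset.range (m []).N,
        phase S (t - (m []).E) (Real.exp ((m []).Z k) * ξ) (m.child k) := by
  split_ifs with h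
  · rw [phase, indicator_of_mem ((hS.mem_iff m hm t).2 (Or.inl h)), Config.W_of_lt hm ht h]
  · by_cases hc : ∀ k < (m []).N, m.child k ∈ S (t - (m []).E)
    · rw [phase, indicator_of_mem ((hS.mem_iff m hm t).2 (Or.inr hc)),
        Config.W_of_le hm (not_lt.1 h) fun k hk => hS.subset_left _ (hc k hk)]
      rw [Complex.ofReal_add, mul_add, Complex.exp_add, Complex.ofReal_sum, Finset.mul_sum,
        Complex.exp_sum]
      congr 1
      refine Finset.prod_congr rfl fun k hk => ?_
      rw [phase, indicator_of_mem (hc k (Finset.mem_range.1 hk))]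
      congr 1
      push_cast
      ring
    · rw [phase, indicator_of_notMem fun h' => ((hS.mem_iff m hm t).1 h').elim h hc]
      push Not at hc
      obtain ⟨k, hk, hk'⟩ := hc
      rw [Finset.prod_eq_zero (Finset.mem_range.2 hk), mul_zero]
      rw [phase, indicator_of_notMem hk']

section Law

variable {law : Measure Mark}

/-- `E[exp(iξW_t); S t]`. -/
noncomputable def meanPhase (law : Measure Mark) (S : ℝ → Set Config) (t ξ : ℝ) : ℂ :=
  ∫ m, phase S t ξ m ∂configLaw law

lemma norm_meanPhase_le {S : ℝ → Set Config} {t : ℝ} (hS : MeasurableSet (S t)) (ξ : ℝ) :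
    ‖meanPhase law S t ξ‖ ≤ (configLaw law).real (S t) := by
  refine (norm_integral_le_integral_norm _).trans_eq ?_
  simp_rw [norm_phase]
  rw [integral_indicator_const _ hS, smul_eq_mul, mul_one]

lemma meanPhase_zero {S : ℝ → Set Config} {t : ℝ} (hS : MeasurableSet (S t)) :
    meanPhase law S t 0 = (configLaw law).real (S t) := by
  simp only [meanPhase, phase, Complex.ofReal_zero, mul_zero, zero_mul, Complex.exp_zero]
  rw [integral_indicator_const _ hS]
  simp

variable [IsProbabilityMeasure law]

instance : IsProbabilityMeasure (configLaw law) := by unfold configLaw; infer_instance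

lemma ae_nonnegLifetimes (hE : ∀ᵐ a ∂law, 0 ≤ a.E) :
    ∀ᵐ m ∂configLaw law, m ∈ Config.nonnegLifetimes := by
  refine ae_all_iff.2 fun x => ?_
  have hx := Measure.infinitePi_map_eval (fun _ : List ℕ => law) x
  rw [← hx] at hE
  have hm : Measurable fun m : Config => m x := measurable_pi_apply x
  exact ae_of_ae_map hm.aemeasurable hE

lemma aemeasurable_W (hE : ∀ᵐ a ∂law, 0 ≤ a.E) {s : Set Config} (hs : MeasurableSet s) (t : ℝ)
    (h : s ⊆ Config.nonexplosive t) :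
    AEMeasurable (fun m => m.W t) ((configLaw law).restrict s) := by
  refine ⟨_, Config.measurable_indicator_W t, ?_⟩
  filter_upwards [ae_restrict_mem hs, ae_restrict_of_ae (ae_nonnegLifetimes hE)] with m h1 h2
  have hmem : m ∈ Config.nonnegLifetimes ∩ Config.nonexplosive t := ⟨h2, h h1⟩
  exact (indicator_of_mem hmem fun m : Config => m.W t).symm

lemma aestronglyMeasurable_exp_W (hE : ∀ᵐ a ∂law, 0 ≤ a.E) {s : Set Config}
    (hs : MeasurableSet s) (t : ℝ) (h : s ⊆ Config.nonexplosive t) (ξ : ℝ) :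
    AEStronglyMeasurable (fun m => Complex.exp (Complex.I * ξ * m.W t))
      ((configLaw law).restrict s) := by
  have h1 : Measurable fun w : ℝ => Complex.exp (Complex.I * ξ * w) := by fun_prop
  exact (h1.comp_aemeasurable (aemeasurable_W hE hs t h)).aestronglyMeasurable

lemma aestronglyMeasurable_phase (hE : ∀ᵐ a ∂law, 0 ≤ a.E) {S : ℝ → Set Config} {t : ℝ}
    (hS : MeasurableSet (S t)) (h : S t ⊆ Config.nonexplosive t) (ξ : ℝ) :
    AEStronglyMeasurable (phase S t ξ) (configLaw law) :=
  (aestronglyMeasurable_indicator_iff hS).2 (aestronglyMeasurable_exp_W hE hS t h ξ)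

lemma integrable_phase (hE : ∀ᵐ a ∂law, 0 ≤ a.E) {S : ℝ → Set Config} {t : ℝ}
    (hS : MeasurableSet (S t)) (h : S t ⊆ Config.nonexplosive t) (ξ : ℝ) :
    Integrable (phase S t ξ) (configLaw law) :=
  Integrable.of_bound (aestronglyMeasurable_phase hE hS h ξ) 1
    (ae_of_all _ (norm_phase_le S t ξ))

lemma continuous_meanPhase (hE : ∀ᵐ a ∂law, 0 ≤ a.E) {S : ℝ → Set Config} {t : ℝ}
    (hS : MeasurableSet (S t)) (h : S t ⊆ Config.nonexplosive t) :
    Continuous (meanPhase law S t) := by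
  refine continuous_of_dominated (bound := fun _ => 1)
    (fun ξ => aestronglyMeasurable_phase hE hS h ξ)
    (fun ξ => ae_of_all _ (norm_phase_le S t ξ)) (integrable_const _) (ae_of_all _ fun m => ?_)
  by_cases hm : m ∈ S t
  · simp only [phase, indicator_of_mem hm]
    fun_prop
  · simp only [phase, indicator_of_notMem hm]
    fun_prop

/-- The contribution of the root mark to `meanPhase`, once the subtrees are averaged out. -/
noncomputable def rootPhase (law : Measure Mark) (S : ℝ → Set Config) (t ξ : ℝ) (a : Mark) : ℂ :=
  if t < a.E then Complex.exp (Complex.I * ξ * a.U) else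
    Complex.exp (Complex.I * ξ * a.C) * ∏ k ∈ Finset.range a.N,
      meanPhase law S (t - a.E) (Real.exp (a.Z k) * ξ)

lemma meanPhase_eq_integral_rootPhase (hE : ∀ᵐ a ∂law, 0 ≤ a.E) {S S' : ℝ → Set Config}
    (hS : BranchingEvents S S') {t : ℝ} (ht : 0 ≤ t) (ξ : ℝ) :
    Integrable (rootPhase law S t ξ) law ∧
      meanPhase law S' t ξ = ∫ a, rootPhase law S t ξ a ∂law := by
  set π : Measure (ℕ → Config) := Measure.infinitePi fun _ => configLaw law with hπ
  have hmap : (law.prod π).map (fun p => Config.graft p.1 p.2) = configLaw law :=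
    Config.map_graft law
  have hint := integrable_phase hE (hS.measurable_right t) (hS.subset_right t) ξ
  rw [← hmap] at hint
  have hint' := (integrable_map_measure hint.1 Config.measurable_graft.aemeasurable).1 hint
  have hnn : ∀ᵐ p ∂(law.prod π), Config.graft p.1 p.2 ∈ Config.nonnegLifetimes := by
    have := ae_nonnegLifetimes hE
    rw [← hmap] at this
    exact ae_of_ae_map Config.measurable_graft.aemeasurable this
  have hinner : ∀ᵐ a ∂law, ∫ c, phase S' t ξ (Config.graft a c) ∂π = rootPhase law S t ξ a := by
    filter_upwards [Measure.ae_ae_of_ae_prod hnn] with a ha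
    have hb := ha.mono fun c hc => phase_branching hS hc ht ξ
    by_cases h : t < a.E
    · have hb' : ∀ᵐ c ∂π, phase S' t ξ (Config.graft a c) =
          Complex.exp (Complex.I * ξ * a.U) := hb.mono fun c hc => hc.trans (if_pos h)
      rw [integral_congr_ae hb', rootPhase, if_pos h]
      simp
    · have hb' : ∀ᵐ c ∂π, phase S' t ξ (Config.graft a c) =
          Complex.exp (Complex.I * ξ * a.C) * ∏ k ∈ Finset.range a.N,
            phase S (t - a.E) (Real.exp (a.Z k) * ξ) (c k) :=
        hb.mono fun c hc => hc.trans (if_neg h)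
      rw [integral_congr_ae hb', rootPhase, if_neg h, integral_const_mul]
      congr 1
      exact integral_prod_range_infinitePi (configLaw law) a.N
        (fun k => phase S (t - a.E) (Real.exp (a.Z k) * ξ)) fun k =>
        aestronglyMeasurable_phase hE (hS.measurable_left _) (hS.subset_left _) _
  refine ⟨hint'.integral_prod_left.congr hinner, ?_⟩
  rw [meanPhase, ← hmap, integral_map Config.measurable_graft.aemeasurable hint.1]
  exact (integral_prod _ hint').trans (integral_congr_ae hinner)

end Law

/-! ### The renewal equation -/

section MarkLaw

lemma norm_smoothing_integrand_le {Ω₀ : Type*} {N : Ω₀ → ℕ} {C : Ω₀ → ℝ} {A : ℕ → Ω₀ → ℝ}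
    {ψ : ℝ → ℂ} (hψ : ∀ ξ, ‖ψ ξ‖ ≤ 1) (ξ : ℝ) (ω : Ω₀) :
    ‖Complex.exp (Complex.I * ξ * C ω) * ∏ k ∈ Finset.range (N ω), ψ (A k ω * ξ)‖ ≤ 1 := by
  rw [norm_mul, norm_exp_I_mul, one_mul, norm_prod]
  exact Finset.prod_le_one (fun _ _ => norm_nonneg _) fun _ _ => hψ _

variable {Ω₀ : Type*} [MeasurableSpace Ω₀] {P : Measure Ω₀} {N : Ω₀ → ℕ} {C : Ω₀ → ℝ}
  {A : ℕ → Ω₀ → ℝ}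

lemma PositiveWeights.ae_pos [IsProbabilityMeasure P] (hN : Measurable N)
    (hA : ∀ k, Measurable (A k)) (h : PositiveWeights P N A) : ∀ᵐ ω ∂P, ∀ k < N ω, 0 < A k ω := by
  have key : ∀ n, ∀ᵐ ω ∂P, N ω = n → ∀ k < n, 0 < A k ω := by
    intro n
    have hs : MeasurableSet {ω | N ω = n} := hN (measurableSet_singleton n)
    by_cases h0 : P {ω | N ω = n} = 0
    · exact (measure_eq_zero_iff_ae_notMem.1 h0).mono fun ω hω h => absurd h hω
    · have hp := cond_isProbabilityMeasure h0
      have hT : MeasurableSet {ω | ∀ k < n, 0 < A k ω} := by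
        have : {ω | ∀ k < n, 0 < A k ω} = ⋂ k, ⋂ _ : k < n, {ω | 0 < A k ω} := by
          ext ω; simp
        rw [this]
        exact MeasurableSet.iInter fun k => MeasurableSet.iInter fun _ =>
          measurableSet_lt measurable_const (hA k)
      have h1 := (prob_compl_eq_zero_iff hT).2 (h n (pos_iff_ne_zero.2 h0))
      rw [cond_apply hs, mul_eq_zero, or_iff_right (by simp)] at h1
      refine (measure_eq_zero_iff_ae_notMem.1 h1).mono fun ω hω h => ?_
      by_contra hk
      exact hω ⟨h, hk⟩
  filter_upwards [ae_all_iff.2 key] with ω hω k hk using hω _ rfl k hk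

lemma measurable_finite_prod {X : Type*} [MeasurableSpace X] {N : X → ℕ} (hN : Measurable N)
    {g : ℕ → X → ℂ} (hg : ∀ k, Measurable (g k)) :
    Measurable fun x => ∏ k ∈ Finset.range (N x), g k x := by
  have h : Measurable fun p : ℕ × X => ∏ k ∈ Finset.range p.1, g k p.2 :=
    measurable_from_prod_countable_right fun n =>
      Finset.measurable_fun_prod (Finset.range n) fun k _ => hg k
  exact h.comp (hN.prodMk measurable_id)

lemma measurable_smoothing_integrand (hN : Measurable N) (hC : Measurable C)
    (hA : ∀ k, Measurable (A k)) {ψ : ℝ → ℂ} (hψ : Continuous ψ) (ξ : ℝ) :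
    Measurable fun ω => Complex.exp (Complex.I * ξ * C ω) *
      ∏ k ∈ Finset.range (N ω), ψ (A k ω * ξ) := by
  refine Measurable.mul (by fun_prop) (measurable_finite_prod hN fun k => ?_)
  exact hψ.measurable.comp ((hA k).mul_const ξ)

lemma measurable_branchingData (hN : Measurable N) (hC : Measurable C)
    (hA : ∀ k, Measurable (A k)) :
    Measurable fun ω => (N ω, C ω, fun k => Real.log (A k ω)) := by
  have : Measurable fun ω => fun k => Real.log (A k ω) :=
    measurable_pi_iff.2 fun k => (hA k).log
  fun_prop

/-- The weights enter a configuration through `log A_k`, and `exp (log A_k) = A_k` holds because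
only the positive weights `A_k`, `k < N`, occur in `smoothing`. -/
lemma integral_branchingData (hN : Measurable N) (hC : Measurable C)
    (hA : ∀ k, Measurable (A k)) (hpos : ∀ᵐ ω ∂P, ∀ k < N ω, 0 < A k ω) {ψ : ℝ → ℂ}
    (hψ : Continuous ψ) (ξ : ℝ) :
    ∫ b, Complex.exp (Complex.I * ξ * b.2.1) * ∏ k ∈ Finset.range b.1, ψ (Real.exp (b.2.2 k) * ξ)
        ∂(P.map fun ω => (N ω, C ω, fun k => Real.log (A k ω))) =
      smoothing P N C A ψ ξ := by
  have hm : Measurable fun b : ℕ × ℝ × (ℕ → ℝ) => Complex.exp (Complex.I * ξ * b.2.1) *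
      ∏ k ∈ Finset.range b.1, ψ (Real.exp (b.2.2 k) * ξ) := by
    refine Measurable.mul (by fun_prop) (measurable_finite_prod measurable_fst fun k => ?_)
    refine hψ.measurable.comp ?_
    fun_prop
  rw [integral_map (measurable_branchingData hN hC hA).aemeasurable hm.aestronglyMeasurable,
    smoothing]
  refine integral_congr_ae (hpos.mono fun ω hω => ?_)
  simp only
  congr 1
  refine Finset.prod_congr rfl fun k hk => ?_
  rw [Real.exp_log (hω k (Finset.mem_range.1 hk))]

lemma expMeasure_one : expMeasure 1 =
    (volume.restrict (Ici 0)).withDensity fun x => ENNReal.ofReal (Real.exp (-x)) := by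
  rw [expMeasure, gammaMeasure, ← withDensity_indicator measurableSet_Ici]
  congr 1
  ext x
  by_cases h : 0 ≤ x
  · rw [indicator_of_mem (show x ∈ Ici 0 from h), gammaPDF_eq, if_pos h]
    simp
  · rw [indicator_of_notMem (show x ∉ Ici 0 from h), gammaPDF_eq, if_neg h]
    simp

lemma ae_nonneg_expMeasure : ∀ᵐ x ∂expMeasure 1, 0 ≤ x := by
  rw [expMeasure_one]
  exact (withDensity_absolutelyContinuous _ _).ae_le (ae_restrict_mem measurableSet_Ici)

lemma integrable_expMeasure_iff {f : ℝ → ℂ} : Integrable f (expMeasure 1) ↔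
    IntegrableOn (fun x => (Real.exp (-x) : ℂ) * f x) (Ici 0) := by
  rw [expMeasure_one, integrable_withDensity_iff_integrable_smul' (by fun_prop)
    (ae_of_all _ fun x => ENNReal.ofReal_lt_top)]
  simp only [ENNReal.toReal_ofReal (Real.exp_pos _).le, Complex.real_smul]
  rfl

lemma integral_expMeasure (f : ℝ → ℂ) :
    ∫ x, f x ∂expMeasure 1 = ∫ x in Ici 0, (Real.exp (-x) : ℂ) * f x := by
  rw [expMeasure_one, integral_withDensity_eq_integral_toReal_smul (by fun_prop)
    (ae_of_all _ fun x => ENNReal.ofReal_lt_top)]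
  simp only [ENNReal.toReal_ofReal (Real.exp_pos _).le, Complex.real_smul]

/-- Conditioning on the first exponential time: either it exceeds `t`, or it is some `t - u`. -/
lemma integral_expMeasure_ite {a : ℂ} {J : ℝ → ℂ} {t : ℝ} (ht : 0 ≤ t)
    (h : Integrable (fun x => if t < x then a else J (t - x)) (expMeasure 1)) :
    IntervalIntegrable (fun u => (Real.exp u : ℂ) * J u) volume 0 t ∧
      (Real.exp t : ℂ) * ∫ x, (if t < x then a else J (t - x)) ∂expMeasure 1 =
        a + ∫ u in 0..t, (Real.exp u : ℂ) * J u := by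
  rw [integrable_expMeasure_iff] at h
  have hu : Ici (0 : ℝ) = Icc 0 t ∪ Ioi t := (Icc_union_Ioi_eq_Ici ht).symm
  rw [hu] at h
  have h1 : IntegrableOn (fun x => (Real.exp (-x) : ℂ) * J (t - x)) (Icc 0 t) :=
    (h.mono_set subset_union_left).congr_fun (fun x hx => by simp [hx.2.not_gt])
      measurableSet_Icc
  have h2 : IntervalIntegrable (fun x => (Real.exp (-x) : ℂ) * J (t - x)) volume 0 t := by
    rw [intervalIntegrable_iff_integrableOn_Ioc_of_le ht]
    exact h1.mono_set Ioc_subset_Icc_self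
  have hexp : ∀ u : ℝ, (Real.exp u : ℂ) * J u =
      (Real.exp t : ℂ) * ((Real.exp (-(t - u)) : ℂ) * J (t - (t - u))) := by
    intro u
    rw [sub_sub_cancel, ← mul_assoc, ← Complex.ofReal_mul, ← Real.exp_add]
    congr 3
    ring
  have h3 : IntervalIntegrable (fun u => (Real.exp u : ℂ) * J u) volume 0 t := by
    have := (h2.comp_sub_left t).symm.const_mul (Real.exp t : ℂ)
    simp only [sub_zero, sub_self] at this
    simpa only [hexp] using this
  refine ⟨h3, ?_⟩
  rw [integral_expMeasure, hu, setIntegral_union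
    (by rw [Set.disjoint_left]; exact fun x hx hx' => absurd hx.2 (not_le.2 hx'))
    measurableSet_Ioi (h.mono_set subset_union_left) (h.mono_set subset_union_right)]
  have e1 : ∫ x in Icc 0 t, (Real.exp (-x) : ℂ) * (if t < x then a else J (t - x)) =
      ∫ x in 0..t, (Real.exp (-x) : ℂ) * J (t - x) := by
    rw [intervalIntegral.integral_of_le ht, ← integral_Icc_eq_integral_Ioc]
    exact setIntegral_congr_fun measurableSet_Icc fun x hx => by simp [hx.2.not_gt]
  have e2 : ∫ x in Ioi t, (Real.exp (-x) : ℂ) * (if t < x then a else J (t - x)) =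
      (Real.exp (-t) : ℂ) * a := by
    rw [← integral_exp_neg_Ioi t, ← integral_complex_ofReal, ← integral_mul_const]
    exact setIntegral_congr_fun measurableSet_Ioi fun x hx => by
      simp only [if_pos (show t < x from hx)]
  have e3 : ∫ u in 0..t, (Real.exp u : ℂ) * J u =
      (Real.exp t : ℂ) * ∫ x in 0..t, (Real.exp (-x) : ℂ) * J (t - x) := by
    have := intervalIntegral.integral_comp_sub_left (a := 0) (b := t)
      (fun x => (Real.exp (-x) : ℂ) * J (t - x)) t
    simp only [sub_zero, sub_self] at this
    rw [← this, ← intervalIntegral.integral_const_mul]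
    exact intervalIntegral.integral_congr fun u _ => hexp u
  rw [e1, e2, e3, mul_add, add_comm, ← mul_assoc, ← Complex.ofReal_mul, ← Real.exp_add]
  simp

variable {ν : Measure ℝ}

lemma isProbabilityMeasure_markLaw [IsProbabilityMeasure P] [IsProbabilityMeasure ν]
    (hN : Measurable N) (hC : Measurable C)
    (hA : ∀ k, Measurable (A k)) : IsProbabilityMeasure (markLaw P N C A ν) := by
  have := Measure.isProbabilityMeasure_map (μ := P) (measurable_branchingData hN hC hA).aemeasurable
  have := isProbabilityMeasure_expMeasure (r := 1) one_pos
  unfold markLaw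
  infer_instance

lemma ae_nonneg_lifetime_markLaw [IsProbabilityMeasure P] [IsProbabilityMeasure ν]
    (hN : Measurable N) (hC : Measurable C)
    (hA : ∀ k, Measurable (A k)) : ∀ᵐ a ∂markLaw P N C A ν, 0 ≤ a.E := by
  have := Measure.isProbabilityMeasure_map (μ := P) (measurable_branchingData hN hC hA).aemeasurable
  have := isProbabilityMeasure_expMeasure (r := 1) one_pos
  exact Measure.quasiMeasurePreserving_fst.ae ae_nonneg_expMeasure

/-- The renewal form of the kinetic equation, for the expectation of `exp(iξW_t)` on an event
that branches at the root. -/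
lemma renewal_meanPhase [IsProbabilityMeasure P] [IsProbabilityMeasure ν]
    (hN : Measurable N) (hC : Measurable C)
    (hA : ∀ k, Measurable (A k)) (hpos : ∀ᵐ ω ∂P, ∀ k < N ω, 0 < A k ω)
    {S S' : ℝ → Set Config} (hS : BranchingEvents S S') {t : ℝ} (ht : 0 ≤ t) (ξ : ℝ) :
    IntervalIntegrable (fun u => (Real.exp u : ℂ) *
        smoothing P N C A (meanPhase (markLaw P N C A ν) S u) ξ) volume 0 t ∧
      (Real.exp t : ℂ) * meanPhase (markLaw P N C A ν) S' t ξ = charFun ν ξ +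
        ∫ u in 0..t, (Real.exp u : ℂ) *
          smoothing P N C A (meanPhase (markLaw P N C A ν) S u) ξ := by
  have hprob := isProbabilityMeasure_markLaw (P := P) (ν := ν) hN hC hA
  have hE := ae_nonneg_lifetime_markLaw (P := P) (ν := ν) hN hC hA
  have hb := Measure.isProbabilityMeasure_map (μ := P)
    (measurable_branchingData hN hC hA).aemeasurable
  have := isProbabilityMeasure_expMeasure (r := 1) one_pos
  obtain ⟨hi, he⟩ := meanPhase_eq_integral_rootPhase hE hS ht ξ
  set law := markLaw P N C A ν with hlaw
  set π := P.map fun ω => (N ω, C ω, fun k => Real.log (A k ω)) with hπ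
  have hi' : Integrable (rootPhase law S t ξ) ((expMeasure 1).prod (ν.prod π)) := hi
  have hJ : ∀ x, ∫ y, rootPhase law S t ξ (x, y) ∂(ν.prod π) =
      if t < x then charFun ν ξ else smoothing P N C A (meanPhase law S (t - x)) ξ := by
    intro x
    split_ifs with h
    · have : ∀ y, rootPhase law S t ξ (x, y) = Complex.exp (ξ * y.1 * Complex.I) := fun y =>
        (if_pos h).trans (by congr 1; simp only [Mark.U]; ring)
      simp only [this]
      rw [charFun_apply_real, integral_fun_fst fun u : ℝ => Complex.exp (ξ * u * Complex.I)]
      simp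
    · have : ∀ y, rootPhase law S t ξ (x, y) = Complex.exp (Complex.I * ξ * y.2.2.1) *
          ∏ k ∈ Finset.range y.2.1, meanPhase law S (t - x) (Real.exp (y.2.2.2 k) * ξ) :=
        fun y => if_neg h
      simp only [this]
      rw [← integral_branchingData hN hC hA hpos
        (continuous_meanPhase hE (hS.measurable_left _) (hS.subset_left _)),
        integral_fun_snd fun b : ℕ × ℝ × (ℕ → ℝ) => Complex.exp (Complex.I * ξ * b.2.1) *
          ∏ k ∈ Finset.range b.1, meanPhase law S (t - x) (Real.exp (b.2.2 k) * ξ)]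
      simp [hπ]
  have h1 := hi'.integral_prod_left
  simp only [hJ] at h1
  have h2 : meanPhase law S' t ξ = ∫ x, (if t < x then charFun ν ξ else
      smoothing P N C A (meanPhase law S (t - x)) ξ) ∂expMeasure 1 := by
    rw [he]
    refine (integral_prod _ hi').trans ?_
    simp only [hJ]
  rw [h2]
  exact integral_expMeasure_ite (J := fun u => smoothing P N C A (meanPhase law S u) ξ) ht h1

end MarkLaw

/-! ### Non-explosion by Osgood's criterion -/

lemma integrable_pow_comp {Ω₀ : Type*} [MeasurableSpace Ω₀] {P : Measure Ω₀}
    [IsFiniteMeasure P] {N : Ω₀ → ℕ} (hN : Measurable N) {s : ℝ} (h0 : 0 ≤ s) (h1 : s ≤ 1) :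
    Integrable (fun ω => s ^ N ω) P := by
  refine Integrable.of_bound
    ((measurable_from_nat (f := fun n : ℕ => s ^ n)).comp hN).aestronglyMeasurable 1
    (ae_of_all _ fun ω => ?_)
  rw [norm_pow, Real.norm_of_nonneg h0]
  exact pow_le_one₀ h0 h1

/-- A generating function with mean offspring larger than one lies strictly below the diagonal
near `1`. -/
lemma Supercritical.exists_lt {Ω₀ : Type*} [MeasurableSpace Ω₀] {P : Measure Ω₀}
    [IsProbabilityMeasure P] {N : Ω₀ → ℕ} (hN : Measurable N) (h : Supercritical P N) :
    ∃ δ > 0, ∀ s ∈ Ioo (1 - δ) (1 : ℝ), ∫ ω, s ^ N ω ∂P < s := by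
  -- The difference quotient `(1 - s^N) / (1 - s)` increases to `N` as `s` increases to `1`.
  let T : ℝ → ENNReal := fun s => ∫⁻ ω, ENNReal.ofReal (∑ j ∈ Finset.range (N ω), s ^ j) ∂P
  have hmeas : ∀ s : ℝ, Measurable fun ω => ∑ j ∈ Finset.range (N ω), s ^ j := fun s =>
    (measurable_from_nat (f := fun n : ℕ => ∑ j ∈ Finset.range n, s ^ j)).comp hN
  have hmono : ∀ {s s' : ℝ}, 0 ≤ s → s ≤ s' → T s ≤ T s' := fun h0 hs =>
    lintegral_mono fun ω => ENNReal.ofReal_le_ofReal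
      (Finset.sum_le_sum fun j _ => pow_le_pow_left₀ h0 hs j)
  let u : ℕ → ℝ := fun n => 1 - 1 / ((n : ℝ) + 1)
  have hu0 : ∀ n, 0 ≤ u n := fun n => by
    have : 1 / ((n : ℝ) + 1) ≤ 1 := by
      rw [div_le_one (by positivity)]; linarith [n.cast_nonneg (α := ℝ)]
    simp only [u]; linarith
  have humono : Monotone u := fun a b hab =>
    sub_le_sub_left (one_div_le_one_div_of_le (by positivity) (by gcongr)) 1
  have hu1 : Tendsto u atTop (𝓝 1) := by
    have := (tendsto_one_div_add_atTop_nhds_zero_nat (𝕜 := ℝ)).const_sub 1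
    rwa [sub_zero] at this
  have hlim : Tendsto (fun n => T (u n)) atTop (𝓝 (∫⁻ ω, (N ω : ENNReal) ∂P)) := by
    refine lintegral_tendsto_of_tendsto_of_monotone
      (fun n => (hmeas _).ennreal_ofReal.aemeasurable) (ae_of_all _ fun ω a b hab => ?_)
      (ae_of_all _ fun ω => ?_)
    · exact ENNReal.ofReal_le_ofReal
        (Finset.sum_le_sum fun j _ => pow_le_pow_left₀ (hu0 a) (humono hab) j)
    · have : Tendsto (fun n => ∑ j ∈ Finset.range (N ω), u n ^ j) atTop
          (𝓝 (∑ j ∈ Finset.range (N ω), (1 : ℝ) ^ j)) :=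
        tendsto_finsetSum _ fun j _ => hu1.pow j
      simpa using ENNReal.tendsto_ofReal this
  obtain ⟨n, hn⟩ := (hlim.eventually_const_lt h).exists
  refine ⟨1 / ((n : ℝ) + 1), by positivity, fun s hs => ?_⟩
  have hs0 : 0 ≤ s := (hu0 n).trans hs.1.le
  have hgeom : ∀ k, (1 - s) * ∑ j ∈ Finset.range k, s ^ j = 1 - s ^ k := fun k =>
    mul_neg_geom_sum s k
  have hT : 1 < T s := hn.trans_le (hmono (hu0 n) hs.1.le)
  have hipow : Integrable (fun ω => s ^ N ω) P := integrable_pow_comp hN hs0 hs.2.le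
  have hsum : ∀ ω, ∑ j ∈ Finset.range (N ω), s ^ j = (1 - s ^ N ω) / (1 - s) := fun ω => by
    rw [eq_div_iff (by linarith [hs.2]), mul_comm, hgeom]
  have hisum : Integrable (fun ω => ∑ j ∈ Finset.range (N ω), s ^ j) P := by
    simp only [hsum]
    exact ((integrable_const 1).sub hipow).div_const _
  have h1 : 1 < ∫ ω, ∑ j ∈ Finset.range (N ω), s ^ j ∂P := by
    have := ofReal_integral_eq_lintegral_ofReal hisum
      (ae_of_all _ fun ω => Finset.sum_nonneg fun j _ => pow_nonneg hs0 j)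
    rw [← ENNReal.one_lt_ofReal, this]
    exact hT
  have h2 : (1 - s) * ∫ ω, ∑ j ∈ Finset.range (N ω), s ^ j ∂P = 1 - ∫ ω, s ^ N ω ∂P := by
    rw [← integral_const_mul]
    simp only [hgeom]
    rw [integral_sub (integrable_const 1) hipow]
    simp
  nlinarith [hs.2]

/-- Osgood's criterion: a solution of `h' = f(h) - h` that starts from the fixed point `1` cannot
leave it downwards, since the time needed to do so is the divergent integral
`∫ ds / (s - f s)`. -/
lemma eq_one_of_osgood {f h : ℝ → ℝ} (h0 : h 0 = 1) (hle : ∀ t, 0 ≤ t → h t ≤ 1)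
    (hd : ∀ t, 0 ≤ t → HasDerivWithinAt h (f (h t) - h t) (Ici 0) t)
    (hf : ∃ δ > 0, ∀ s ∈ Ioo (1 - δ) 1, f s < s)
    (hint : ∀ᶠ ε in 𝓝[>] (0 : ℝ), ∫⁻ s in Ioo (1 - ε) 1, ENNReal.ofReal (1 / (s - f s)) = ⊤)
    {t : ℝ} (ht : 0 ≤ t) : h t = 1 := by
  by_contra hne
  have hc : ContinuousOn h (Ici 0) := fun s hs => (hd s hs).continuousWithinAt
  have hcI : ContinuousOn h (Icc 0 t) := hc.mono Icc_subset_Ici_self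
  -- `t₀` is the last time before `t` at which `h = 1`.
  obtain ⟨t₀, ⟨ht₀, ht₀1⟩, hub⟩ : ∃ t₀, IsGreatest (Icc 0 t ∩ h ⁻¹' {1}) t₀ := by
    refine IsCompact.exists_isGreatest ?_ ⟨0, ⟨le_rfl, ht⟩, h0⟩
    exact isCompact_Icc.of_isClosed_subset
      (hcI.preimage_isClosed_of_isClosed isClosed_Icc isClosed_singleton) inter_subset_left
  rw [mem_preimage, mem_singleton_iff] at ht₀1
  have hlt : t₀ < t := ht₀.2.lt_of_ne fun h => hne (h ▸ ht₀1)
  have hlt1 : ∀ s ∈ Ioc t₀ t, h s < 1 := fun s hs =>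
    (hle s (ht₀.1.trans hs.1.le)).lt_of_ne fun h1 =>
      (hub ⟨⟨ht₀.1.trans hs.1.le, hs.2⟩, h1⟩).not_gt hs.1
  obtain ⟨δ, hδ, hf⟩ := hf
  obtain ⟨ε, hε, hint⟩ := mem_nhdsGT_iff_exists_Ioo_subset.1 hint
  obtain ⟨t₁, ht₁, hnear⟩ : ∃ t₁ ∈ Ioc t₀ t, ∀ s ∈ Ioc t₀ t₁, 1 - min δ ε < h s := by
    have hcw : Tendsto h (𝓝[>] t₀) (𝓝 (h t₀)) :=
      (hc t₀ ht₀.1).mono fun s hs => ht₀.1.trans (le_of_lt hs)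
    have hmin : 1 - min δ ε < h t₀ := by rw [ht₀1]; linarith [lt_min hδ hε]
    obtain ⟨b, hb, hsub⟩ := mem_nhdsGT_iff_exists_Ioc_subset.1 (hcw.eventually_const_lt hmin)
    exact ⟨min b t, ⟨lt_min hb hlt, min_le_right _ _⟩,
      fun s hs => hsub ⟨hs.1, hs.2.trans (min_le_left _ _)⟩⟩
  have hfs : ∀ s ∈ Ioc t₀ t₁, f (h s) < h s := fun s hs =>
    hf _ ⟨by linarith [hnear s hs, min_le_left δ ε], hlt1 s ⟨hs.1, hs.2.trans ht₁.2⟩⟩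
  have hda : ∀ s ∈ Ioo t₀ t₁, HasDerivAt h (f (h s) - h s) s := fun s hs =>
    (hd s (ht₀.1.trans hs.1.le)).hasDerivAt (Ici_mem_nhds (ht₀.1.trans_lt hs.1))
  have hc1 : ContinuousOn h (Icc t₀ t₁) := hc.mono fun s hs => ht₀.1.trans hs.1
  have hanti : StrictAntiOn h (Icc t₀ t₁) := by
    refine strictAntiOn_of_deriv_neg (convex_Icc _ _) hc1 fun s hs => ?_
    rw [interior_Icc] at hs
    rw [(hda s hs).deriv]
    linarith [hfs s ⟨hs.1, hs.2.le⟩]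
  have hsub : Ioo (h t₁) 1 ⊆ h '' Ioo t₀ t₁ := by
    rw [← ht₀1]
    exact intermediate_value_Ioo' ht₁.1.le hc1
  have htop := hint ⟨sub_pos.2 (hlt1 t₁ ht₁), show 1 - h t₁ < ε by
    linarith [hnear t₁ ⟨ht₁.1, le_rfl⟩, min_le_right δ ε]⟩
  rw [mem_ofPred_eq, sub_sub_cancel] at htop
  have hle2 : (⊤ : ENNReal) ≤ volume (Ioo t₀ t₁) := by
    rw [← htop]
    refine (lintegral_mono_set hsub).trans_eq ?_
    rw [lintegral_image_eq_lintegral_abs_deriv_mul measurableSet_Ioo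
      (fun s hs => (hda s hs).hasDerivWithinAt) (hanti.injOn.mono Ioo_subset_Icc_self)]
    rw [← setLIntegral_one]
    refine setLIntegral_congr_fun measurableSet_Ioo fun s hs => ?_
    have hpos : 0 < h s - f (h s) := sub_pos.2 (hfs s ⟨hs.1, hs.2.le⟩)
    rw [← ENNReal.ofReal_mul (abs_nonneg _), abs_sub_comm, abs_of_pos hpos,
      mul_one_div_cancel hpos.ne', ENNReal.ofReal_one]
  rw [Real.volume_Ioo] at hle2
  exact absurd hle2 (not_le.2 ENNReal.ofReal_lt_top)

/-! ### Variation of constants -/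

section VariationOfConstants

variable {y J : ℝ → ℂ} {a : ℂ}

lemma continuousOn_of_renewal
    (hJ : ∀ t, 0 ≤ t → IntervalIntegrable (fun u => (Real.exp u : ℂ) * J u) volume 0 t)
    (h : ∀ t, 0 ≤ t → (Real.exp t : ℂ) * y t = a + ∫ u in 0..t, (Real.exp u : ℂ) * J u) :
    ContinuousOn y (Ici 0) := by
  have hprim : ContinuousOn (fun t => ∫ u in 0..t, (Real.exp u : ℂ) * J u) (Ici 0) := by
    intro t ht
    have ht1 : (0 : ℝ) ≤ t + 1 := add_nonneg ht zero_le_one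
    have hi := (intervalIntegrable_iff_integrableOn_Icc_of_le ht1).1 (hJ (t + 1) ht1)
    rw [← uIcc_of_le ht1] at hi
    have hct := intervalIntegral.continuousOn_primitive_interval hi
    rw [uIcc_of_le ht1] at hct
    refine (hct t ⟨ht, by linarith⟩).mono_of_mem_nhdsWithin ?_
    rw [← Ici_inter_Iic]
    exact inter_mem self_mem_nhdsWithin (mem_nhdsWithin_of_mem_nhds (Iic_mem_nhds (by linarith)))
  have hy : ∀ t ∈ Ici (0 : ℝ), y t =
      (Real.exp (-t) : ℂ) * (a + ∫ u in 0..t, (Real.exp u : ℂ) * J u) := fun t ht => by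
    rw [← h t ht, ← mul_assoc, ← Complex.ofReal_mul, ← Real.exp_add]
    simp
  refine ContinuousOn.congr (ContinuousOn.mul ?_ (continuousOn_const.add hprim)) hy
  fun_prop

lemma hasDerivWithinAt_of_renewal (hJ : ContinuousOn J (Ici 0))
    (h : ∀ t, 0 ≤ t → (Real.exp t : ℂ) * y t = a + ∫ u in 0..t, (Real.exp u : ℂ) * J u)
    {t : ℝ} (ht : 0 ≤ t) : HasDerivWithinAt y (J t - y t) (Ici 0) t := by
  -- `J` is extended to negative times by its value at `0`, to have a continuous integrand.
  have hc : Continuous fun u : ℝ => (Real.exp u : ℂ) * J (max u 0) := by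
    refine Continuous.mul (by fun_prop) ?_
    exact hJ.comp_continuous (by fun_prop) fun u => le_max_right u 0
  have hG : HasDerivAt (fun t : ℝ => Complex.exp (-(t : ℂ)) *
      (a + ∫ u in 0..t, (Real.exp u : ℂ) * J (max u 0)))
      (Complex.exp (-(t : ℂ)) * -1 * (a + ∫ u in 0..t, (Real.exp u : ℂ) * J (max u 0)) +
        Complex.exp (-(t : ℂ)) * ((Real.exp t : ℂ) * J (max t 0))) t := by
    refine HasDerivAt.mul ?_ ?_
    · exact (Complex.ofRealCLM.hasDerivAt.neg).cexp
    · exact (intervalIntegral.integral_hasDerivAt_right (hc.intervalIntegrable _ _)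
        (hc.stronglyMeasurableAtFilter _ _) hc.continuousAt).const_add a
  have hy : ∀ t ∈ Ici (0 : ℝ), y t =
      Complex.exp (-(t : ℂ)) * (a + ∫ u in 0..t, (Real.exp u : ℂ) * J (max u 0)) := by
    intro t ht
    have hI : ∫ u in 0..t, (Real.exp u : ℂ) * J (max u 0) =
        ∫ u in 0..t, (Real.exp u : ℂ) * J u := by
      refine intervalIntegral.integral_congr fun u hu => ?_
      rw [uIcc_of_le ht] at hu
      simp only [max_eq_left hu.1]
    rw [hI, ← h t ht, ← mul_assoc, Complex.ofReal_exp, ← Complex.exp_add]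
    simp
  refine (hG.hasDerivWithinAt.congr hy (hy t ht)).congr_deriv ?_
  rw [hy t ht, max_eq_left ht, Complex.ofReal_exp, ← mul_assoc (Complex.exp _) (Complex.exp _),
    ← Complex.exp_add]
  simp
  ring

lemma renewal_of_hasDerivWithinAt (hJ : ContinuousOn J (Ici 0))
    (h : ∀ t, 0 ≤ t → HasDerivWithinAt y (J t - y t) (Ici 0) t) {t : ℝ} (ht : 0 ≤ t) :
    (Real.exp t : ℂ) * y t = y 0 + ∫ u in 0..t, (Real.exp u : ℂ) * J u := by
  have hd : ∀ s, 0 ≤ s →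
      HasDerivWithinAt (fun u : ℝ => (Real.exp u : ℂ) * y u) ((Real.exp s : ℂ) * J s)
        (Ici 0) s := by
    intro s hs
    have h1 : HasDerivWithinAt (fun u : ℝ => (Real.exp u : ℂ)) (Real.exp s : ℂ) (Ici 0) s :=
      (Real.hasDerivAt_exp s).ofReal_comp.hasDerivWithinAt
    refine (h1.mul (h s hs)).congr_deriv ?_
    ring
  have hint := intervalIntegral.integral_eq_sub_of_hasDeriv_right
    (f := fun u : ℝ => (Real.exp u : ℂ) * y u) (f' := fun u => (Real.exp u : ℂ) * J u)
    (a := 0) (b := t) ?_ ?_ ?_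
  · rw [hint]; simp
  · rw [uIcc_of_le ht]
    exact fun s hs => (hd s hs.1).continuousWithinAt.mono Icc_subset_Ici_self
  · intro s hs
    rw [min_eq_left ht] at hs
    exact (hd s hs.1.le).mono fun r hr => hs.1.le.trans (le_of_lt hr)
  · refine ContinuousOn.intervalIntegrable ?_
    rw [uIcc_of_le ht]
    exact ContinuousOn.mul (by fun_prop) (hJ.mono Icc_subset_Ici_self)

end VariationOfConstants

/-! ### Existence, uniqueness and representation -/

/-- A telescoping bound. The sharper bound on the second factors is what keeps it at `1 - h ^ n`
rather than `n * (1 - h)`. -/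
lemma norm_prod_sub_prod_le {a b : ℕ → ℂ} {h : ℝ} (ha : ∀ k, ‖a k‖ ≤ 1)
    (hb : ∀ k, ‖b k‖ ≤ h) (hab : ∀ k, ‖a k - b k‖ ≤ 1 - h) (n : ℕ) :
    ‖∏ k ∈ Finset.range n, a k - ∏ k ∈ Finset.range n, b k‖ ≤ 1 - h ^ n := by
  induction n with
  | zero => simp
  | succ n ih =>
    have hpa : ‖∏ k ∈ Finset.range n, b k‖ ≤ h ^ n := by
      rw [norm_prod]
      exact (Finset.prod_le_prod (fun _ _ => norm_nonneg _) fun k _ => hb k).trans_eq (by simp)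
    rw [Finset.prod_range_succ, Finset.prod_range_succ]
    calc ‖(∏ k ∈ Finset.range n, a k) * a n - (∏ k ∈ Finset.range n, b k) * b n‖
        = ‖(∏ k ∈ Finset.range n, a k - ∏ k ∈ Finset.range n, b k) * a n +
            (∏ k ∈ Finset.range n, b k) * (a n - b n)‖ := by congr 1; ring
      _ ≤ ‖∏ k ∈ Finset.range n, a k - ∏ k ∈ Finset.range n, b k‖ * ‖a n‖ +
            ‖∏ k ∈ Finset.range n, b k‖ * ‖a n - b n‖ := by
          refine (norm_add_le _ _).trans ?_
          rw [norm_mul, norm_mul]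
      _ ≤ (1 - h ^ n) * 1 + h ^ n * (1 - h) := by
          refine add_le_add ?_ ?_
          · exact mul_le_mul ih (ha n) (norm_nonneg _) ((norm_nonneg _).trans ih)
          · exact mul_le_mul hpa (hab n) (norm_nonneg _) ((norm_nonneg _).trans hpa)
      _ = 1 - h ^ (n + 1) := by ring

section Equation

variable {Ω₀ : Type*} [MeasurableSpace Ω₀] {P : Measure Ω₀} [IsProbabilityMeasure P]
  {N : Ω₀ → ℕ} {C : Ω₀ → ℝ} {A : ℕ → Ω₀ → ℝ}

lemma continuousOn_smoothing (hN : Measurable N) (hC : Measurable C)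
    (hA : ∀ k, Measurable (A k)) {y : ℝ → ℝ → ℂ} (hy : ∀ t, 0 ≤ t → Continuous (y t))
    (hy1 : ∀ t, 0 ≤ t → ∀ ξ, ‖y t ξ‖ ≤ 1) (hyt : ∀ ξ, ContinuousOn (fun t => y t ξ) (Ici 0))
    (ξ : ℝ) : ContinuousOn (fun t => smoothing P N C A (y t) ξ) (Ici 0) := by
  refine continuousOn_of_dominated (bound := fun _ => 1)
    (fun t ht => (measurable_smoothing_integrand hN hC hA (hy t ht) ξ).aestronglyMeasurable)
    (fun t ht => ae_of_all _ (norm_smoothing_integrand_le (hy1 t ht) ξ)) (integrable_const _)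
    (ae_of_all _ fun ω => ?_)
  exact continuousOn_const.mul (continuousOn_finsetProd _ fun k _ => hyt _)

lemma smoothing_zero {P : Measure Ω₀} {ψ : ℝ → ℂ} {s : ℝ} (h : ψ 0 = s) :
    smoothing P N C A ψ 0 = ((∫ ω, s ^ N ω ∂P : ℝ) : ℂ) := by
  simp only [smoothing, mul_zero, Complex.ofReal_zero, zero_mul, Complex.exp_zero, one_mul, h,
    Finset.prod_const, Finset.card_range]
  rw [← integral_complex_ofReal]
  simp

lemma norm_smoothing_sub_le (hN : Measurable N) (hC : Measurable C)
    (hA : ∀ k, Measurable (A k)) {ψ χ : ℝ → ℂ} (hψ : Continuous ψ) (hχ : Continuous χ) {s : ℝ}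
    (h0 : 0 ≤ s) (h1 : s ≤ 1) (hψ1 : ∀ ξ, ‖ψ ξ‖ ≤ 1) (hχ1 : ∀ ξ, ‖χ ξ‖ ≤ s)
    (hd : ∀ ξ, ‖ψ ξ - χ ξ‖ ≤ 1 - s) (ξ : ℝ) :
    ‖smoothing P N C A ψ ξ - smoothing P N C A χ ξ‖ ≤ 1 - ∫ ω, s ^ N ω ∂P := by
  have hint : ∀ {ψ : ℝ → ℂ}, Continuous ψ → (∀ ξ, ‖ψ ξ‖ ≤ 1) → Integrable (fun ω =>
      Complex.exp (Complex.I * ξ * C ω) * ∏ k ∈ Finset.range (N ω), ψ (A k ω * ξ)) P :=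
    fun hψ hψ1 => Integrable.of_bound
      (measurable_smoothing_integrand hN hC hA hψ ξ).aestronglyMeasurable 1
      (ae_of_all _ (norm_smoothing_integrand_le hψ1 ξ))
  have hpow := integrable_pow_comp (P := P) hN h0 h1
  rw [smoothing, smoothing,
    ← integral_sub (hint hψ hψ1) (hint hχ fun ξ => (hχ1 ξ).trans h1)]
  have hr : 1 - ∫ ω, s ^ N ω ∂P = ∫ ω, (1 - s ^ N ω) ∂P := by
    rw [integral_sub (integrable_const 1) hpow]
    simp
  rw [hr]
  refine norm_integral_le_of_norm_le ((integrable_const 1).sub hpow) (ae_of_all _ fun ω => ?_)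
  rw [← mul_sub, norm_mul, norm_exp_I_mul, one_mul]
  exact norm_prod_sub_prod_le (fun _ => hψ1 _) (fun _ => hχ1 _) (fun _ => hd _) _

variable {ν : Measure ℝ} [IsProbabilityMeasure ν]

lemma norm_meanPhase_le_one (hN : Measurable N) (hC : Measurable C)
    (hA : ∀ k, Measurable (A k)) {S : ℝ → Set Config} {t : ℝ} (hS : MeasurableSet (S t)) (ξ : ℝ) :
    ‖meanPhase (markLaw P N C A ν) S t ξ‖ ≤ 1 := by
  have hprob := isProbabilityMeasure_markLaw (P := P) (ν := ν) hN hC hA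
  exact (norm_meanPhase_le hS ξ).trans measureReal_le_one

lemma continuous_meanPhase_markLaw (hN : Measurable N) (hC : Measurable C)
    (hA : ∀ k, Measurable (A k)) {S : ℝ → Set Config} {t : ℝ} (hS : MeasurableSet (S t))
    (h : S t ⊆ Config.nonexplosive t) : Continuous (meanPhase (markLaw P N C A ν) S t) := by
  have hprob := isProbabilityMeasure_markLaw (P := P) (ν := ν) hN hC hA
  exact continuous_meanPhase (ae_nonneg_lifetime_markLaw hN hC hA) hS h

/-- The expectation of `exp(iξW_t)` on the nonexplosive configurations solves the equation,
whether or not these configurations have full probability. -/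
lemma hasDerivWithinAt_meanPhase (hN : Measurable N) (hC : Measurable C)
    (hA : ∀ k, Measurable (A k)) (hpos : ∀ᵐ ω ∂P, ∀ k < N ω, 0 < A k ω) (ξ : ℝ) {t : ℝ}
    (ht : 0 ≤ t) :
    HasDerivWithinAt (fun t => meanPhase (markLaw P N C A ν) Config.nonexplosive t ξ)
      (smoothing P N C A (meanPhase (markLaw P N C A ν) Config.nonexplosive t) ξ -
        meanPhase (markLaw P N C A ν) Config.nonexplosive t ξ) (Ici 0) t := by
  have hr := fun (ξ t : ℝ) (ht : 0 ≤ t) =>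
    renewal_meanPhase (P := P) (ν := ν) hN hC hA hpos branchingEvents_nonexplosive ht ξ
  have hc : ∀ ξ, ContinuousOn
      (fun t => meanPhase (markLaw P N C A ν) Config.nonexplosive t ξ) (Ici 0) := fun ξ =>
    continuousOn_of_renewal (fun t ht => (hr ξ t ht).1) fun t ht => (hr ξ t ht).2
  refine hasDerivWithinAt_of_renewal
    (J := fun t => smoothing P N C A (meanPhase (markLaw P N C A ν) Config.nonexplosive t) ξ)
    (continuousOn_smoothing hN hC hA (fun t _ => ?_) (fun t _ => ?_) hc ξ)
    (fun t ht => (hr ξ t ht).2) ht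
  · exact continuous_meanPhase_markLaw hN hC hA (Config.measurableSet_nonexplosive t) subset_rfl
  · exact norm_meanPhase_le_one hN hC hA (Config.measurableSet_nonexplosive t)

lemma meanPhase_initial (hN : Measurable N) (hC : Measurable C)
    (hA : ∀ k, Measurable (A k)) (hpos : ∀ᵐ ω ∂P, ∀ k < N ω, 0 < A k ω) (ξ : ℝ) :
    meanPhase (markLaw P N C A ν) Config.nonexplosive 0 ξ = charFun ν ξ := by
  simpa using (renewal_meanPhase (P := P) (ν := ν) hN hC hA hpos branchingEvents_nonexplosive
    le_rfl ξ).2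

/-- Under the non-explosion condition, only finitely many generations are reached by time `t`. -/
lemma measureReal_nonexplosive (hN : Measurable N) (hC : Measurable C)
    (hA : ∀ k, Measurable (A k)) (hpos : ∀ᵐ ω ∂P, ∀ k < N ω, 0 < A k ω)
    (hexp : NonExplosion P N) (hsup : Supercritical P N) {t : ℝ} (ht : 0 ≤ t) :
    (configLaw (markLaw P N C A ν)).real (Config.nonexplosive t) = 1 := by
  have hprob := isProbabilityMeasure_markLaw (P := P) (ν := ν) hN hC hA
  have hz := fun t => meanPhase_zero (law := markLaw P N C A ν)
    (Config.measurableSet_nonexplosive t)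
  refine eq_one_of_osgood (f := fun s => ∫ ω, s ^ N ω ∂P)
    (h := fun t => (configLaw (markLaw P N C A ν)).real (Config.nonexplosive t)) ?_
    (fun t _ => measureReal_le_one) (fun t ht => ?_) (hsup.exists_lt hN) hexp ht
  · have h0 := hz 0
    rw [meanPhase_initial hN hC hA hpos, charFun_zero] at h0
    simpa using h0.symm
  · have hd := hasDerivWithinAt_meanPhase (ν := ν) hN hC hA hpos 0 ht
    rw [smoothing_zero (hz t)] at hd
    simp only [hz] at hd
    have := Complex.reCLM.hasFDerivAt.comp_hasDerivWithinAt t hd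
    simpa [Function.comp_def] using this

lemma ae_nonexplosive (hN : Measurable N) (hC : Measurable C)
    (hA : ∀ k, Measurable (A k)) (hpos : ∀ᵐ ω ∂P, ∀ k < N ω, 0 < A k ω)
    (hexp : NonExplosion P N) (hsup : Supercritical P N) {t : ℝ} (ht : 0 ≤ t) :
    ∀ᵐ m ∂configLaw (markLaw P N C A ν), m ∈ Config.nonexplosive t := by
  have hprob := isProbabilityMeasure_markLaw (P := P) (ν := ν) hN hC hA
  refine mem_ae_iff.2 ((prob_compl_eq_zero_iff (Config.measurableSet_nonexplosive t)).2 ?_)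
  have := measureReal_nonexplosive (ν := ν) hN hC hA hpos hexp hsup ht
  rwa [measureReal_def, ENNReal.toReal_eq_one_iff] at this

lemma meanPhase_nonexplosive (hN : Measurable N) (hC : Measurable C)
    (hA : ∀ k, Measurable (A k)) (hpos : ∀ᵐ ω ∂P, ∀ k < N ω, 0 < A k ω)
    (hexp : NonExplosion P N) (hsup : Supercritical P N) {t : ℝ} (ht : 0 ≤ t) (ξ : ℝ) :
    meanPhase (markLaw P N C A ν) Config.nonexplosive t ξ =
      ∫ m, Complex.exp (Complex.I * ξ * m.W t) ∂configLaw (markLaw P N C A ν) :=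
  integral_congr_ae ((ae_nonexplosive hN hC hA hpos hexp hsup ht).mono fun _ hm =>
    indicator_of_mem hm _)

lemma aemeasurable_W_configLaw (hN : Measurable N) (hC : Measurable C)
    (hA : ∀ k, Measurable (A k)) (hpos : ∀ᵐ ω ∂P, ∀ k < N ω, 0 < A k ω)
    (hexp : NonExplosion P N) (hsup : Supercritical P N) {t : ℝ} (ht : 0 ≤ t) :
    AEMeasurable (fun m => m.W t) (configLaw (markLaw P N C A ν)) := by
  have hprob := isProbabilityMeasure_markLaw (P := P) (ν := ν) hN hC hA
  have h := aemeasurable_W (ae_nonneg_lifetime_markLaw (P := P) (ν := ν) hN hC hA)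
    (Config.measurableSet_nonexplosive t) t subset_rfl
  rwa [Measure.restrict_eq_self_of_ae_mem
    (ae_nonexplosive (ν := ν) hN hC hA hpos hexp hsup ht)] at h

/-- Any solution is approximated by the expectation of `exp(iξW_t)` on the event that only
generations below `n` are reached by time `t`, with an error of at most the probability of the
complement. -/
lemma norm_sub_meanPhase_depthLT_le (hN : Measurable N) (hC : Measurable C)
    (hA : ∀ k, Measurable (A k)) (hpos : ∀ᵐ ω ∂P, ∀ k < N ω, 0 < A k ω) {y : ℝ → ℝ → ℂ}
    (hy : ∀ t, 0 ≤ t → Continuous (y t)) (hy1 : ∀ t, 0 ≤ t → ∀ ξ, ‖y t ξ‖ ≤ 1)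
    (hsol : SolvesKineticEquation P N C A ν y) (n : ℕ) {t : ℝ} (ht : 0 ≤ t) (ξ : ℝ) :
    ‖y t ξ - meanPhase (markLaw P N C A ν) (Config.depthLT n) t ξ‖ ≤
      1 - (configLaw (markLaw P N C A ν)).real (Config.depthLT n t) := by
  have hprob := isProbabilityMeasure_markLaw (P := P) (ν := ν) hN hC hA
  have hsm : ∀ ξ, ContinuousOn (fun t => smoothing P N C A (y t) ξ) (Ici 0) :=
    continuousOn_smoothing hN hC hA hy hy1 fun ξ t ht => (hsol.1 t ht ξ).continuousWithinAt
  induction n generalizing t ξ with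
  | zero =>
    have : meanPhase (markLaw P N C A ν) (Config.depthLT 0) t ξ = 0 := by
      simp [meanPhase, phase, Config.depthLT_zero ht]
    rw [this, Config.depthLT_zero ht]
    simpa using hy1 t ht ξ
  | succ n ih =>
    set law := markLaw P N C A ν
    set F := meanPhase law (Config.depthLT n) 
    set p : ℝ → ℝ := fun u => (configLaw law).real (Config.depthLT n u)
    set q : ℝ → ℝ := fun u => ∫ ω, p u ^ N ω ∂P
    have hren : ∀ ξ, IntervalIntegrable (fun u => (Real.exp u : ℂ) *
          smoothing P N C A (F u) ξ) volume 0 t ∧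
        (Real.exp t : ℂ) * meanPhase law (Config.depthLT (n + 1)) t ξ = charFun ν ξ +
          ∫ u in 0..t, (Real.exp u : ℂ) * smoothing P N C A (F u) ξ := fun ξ =>
      renewal_meanPhase hN hC hA hpos (branchingEvents_depthLT n) ht ξ
    have hyren := renewal_of_hasDerivWithinAt (hsm ξ) (fun t ht => hsol.1 t ht ξ) ht
    rw [hsol.2 ξ] at hyren
    have hq0 : ∀ u, smoothing P N C A (F u) 0 = (q u : ℂ) := fun u =>
      smoothing_zero (meanPhase_zero (Config.measurableSet_depthLT n u))
    -- The renewal equation at `ξ = 0` is the one for the probability of `depthLT`.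
    obtain ⟨hqi, hqe⟩ := hren 0
    rw [meanPhase_zero (Config.measurableSet_depthLT (n + 1) t), charFun_zero] at hqe
    simp only [hq0, ← Complex.ofReal_mul] at hqi hqe
    rw [intervalIntegral.integral_ofReal] at hqe
    have hqe' : Real.exp t * (configLaw law).real (Config.depthLT (n + 1) t) =
        1 + ∫ u in 0..t, Real.exp u * q u := by
      have h1 : ν.real univ = 1 := by simp
      rw [h1] at hqe
      exact_mod_cast hqe
    have hqi' : IntervalIntegrable (fun u => Real.exp u * q u) volume 0 t := by
      rw [intervalIntegrable_iff] at hqi ⊢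
      exact hqi.re
    have hei : IntervalIntegrable Real.exp volume 0 t := Real.continuous_exp.intervalIntegrable _ _
    have hyi : IntervalIntegrable (fun u => (Real.exp u : ℂ) * smoothing P N C A (y u) ξ)
        volume 0 t := by
      refine ContinuousOn.intervalIntegrable ?_
      rw [uIcc_of_le ht]
      exact ContinuousOn.mul (by fun_prop) ((hsm ξ).mono Icc_subset_Ici_self)
    have hdiff : (Real.exp t : ℂ) * (y t ξ - meanPhase law (Config.depthLT (n + 1)) t ξ) =
        ∫ u in 0..t, ((Real.exp u : ℂ) * smoothing P N C A (y u) ξ -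
          (Real.exp u : ℂ) * smoothing P N C A (F u) ξ) := by
      rw [intervalIntegral.integral_sub hyi (hren ξ).1, mul_sub, hyren, (hren ξ).2]
      ring
    have hcompl : Real.exp t * (1 - (configLaw law).real (Config.depthLT (n + 1) t)) =
        ∫ u in 0..t, (Real.exp u - Real.exp u * q u) := by
      rw [intervalIntegral.integral_sub hei hqi', integral_exp, mul_sub, hqe', Real.exp_zero]
      ring
    refine le_of_mul_le_mul_left ?_ (Real.exp_pos t)
    have hnorm : Real.exp t * ‖y t ξ - meanPhase law (Config.depthLT (n + 1)) t ξ‖ =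
        ‖(Real.exp t : ℂ) * (y t ξ - meanPhase law (Config.depthLT (n + 1)) t ξ)‖ := by
      rw [norm_mul, Complex.norm_real, Real.norm_of_nonneg (Real.exp_pos t).le]
    rw [hnorm, hdiff, hcompl]
    refine intervalIntegral.norm_integral_le_of_norm_le ht (ae_of_all _ fun u hu => ?_)
      (hei.sub hqi')
    rw [← mul_sub, norm_mul, Complex.norm_real, Real.norm_of_nonneg (Real.exp_pos u).le,
      ← mul_one_sub]
    refine mul_le_mul_of_nonneg_left ?_ (Real.exp_pos u).le
    exact norm_smoothing_sub_le hN hC hA (hy u hu.1.le)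
      (continuous_meanPhase_markLaw hN hC hA (Config.measurableSet_depthLT n u)
        ((branchingEvents_depthLT n).subset_left u))
      measureReal_nonneg measureReal_le_one (hy1 u hu.1.le)
      (norm_meanPhase_le (Config.measurableSet_depthLT n u)) (fun ξ => ih hu.1.le ξ) ξ

/-- Two solutions share the approximations by generation, which become exact in the limit. -/
lemma solution_unique (hN : Measurable N) (hC : Measurable C)
    (hA : ∀ k, Measurable (A k)) (hpos : ∀ᵐ ω ∂P, ∀ k < N ω, 0 < A k ω)
    (hexp : NonExplosion P N) (hsup : Supercritical P N) {y z : ℝ → ℝ → ℂ}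
    (hy : SolutionClass y) (hz : SolutionClass z) (hys : SolvesKineticEquation P N C A ν y)
    (hzs : SolvesKineticEquation P N C A ν z) {t : ℝ} (ht : 0 ≤ t) (ξ : ℝ) : y t ξ = z t ξ := by
  have hprob := isProbabilityMeasure_markLaw (P := P) (ν := ν) hN hC hA
  have hcont : ∀ {y : ℝ → ℝ → ℂ}, SolutionClass y → ∀ t, 0 ≤ t → Continuous (y t) := by
    intro y hy t ht
    obtain ⟨μ, hμ, h⟩ := hy.1 t ht
    rw [funext h]
    exact continuous_charFun
  have hbound : ∀ {y : ℝ → ℝ → ℂ}, SolutionClass y → ∀ t, 0 ≤ t → ∀ ξ, ‖y t ξ‖ ≤ 1 := by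
    intro y hy t ht ξ
    obtain ⟨μ, hμ, h⟩ := hy.1 t ht
    rw [h]
    exact norm_charFun_le_one ξ
  have hlim : Tendsto (fun n => (1 - (configLaw (markLaw P N C A ν)).real (Config.depthLT n t)) +
      (1 - (configLaw (markLaw P N C A ν)).real (Config.depthLT n t))) atTop (𝓝 0) := by
    have h1 : Tendsto (fun n => (configLaw (markLaw P N C A ν)).real (Config.depthLT n t)) atTop
        (𝓝 ((configLaw (markLaw P N C A ν)).real (Config.nonexplosive t))) :=
      (ENNReal.tendsto_toReal (measure_ne_top _ _)).comp
        (tendsto_measure_iUnion_atTop (Config.depthLT_mono t))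
    rw [measureReal_nonexplosive hN hC hA hpos hexp hsup ht] at h1
    simpa using (h1.const_sub 1).add (h1.const_sub 1)
  refine sub_eq_zero.1 (norm_le_zero_iff.1 (ge_of_tendsto' hlim fun n => ?_))
  refine (norm_sub_le_norm_sub_add_norm_sub _
    (meanPhase (markLaw P N C A ν) (Config.depthLT n) t ξ) _).trans (add_le_add ?_ ?_)
  · exact norm_sub_meanPhase_depthLT_le hN hC hA hpos (hcont hy) (hbound hy) hys n ht ξ
  · rw [norm_sub_rev]
    exact norm_sub_meanPhase_depthLT_le hN hC hA hpos (hcont hz) (hbound hz) hzs n ht ξ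

lemma solvesKineticEquation_meanPhase (hN : Measurable N) (hC : Measurable C)
    (hA : ∀ k, Measurable (A k)) (hpos : ∀ᵐ ω ∂P, ∀ k < N ω, 0 < A k ω) :
    SolvesKineticEquation P N C A ν (meanPhase (markLaw P N C A ν) Config.nonexplosive) :=
  ⟨fun _ ht ξ => hasDerivWithinAt_meanPhase hN hC hA hpos ξ ht,
    meanPhase_initial hN hC hA hpos⟩

lemma solutionClass_meanPhase (hN : Measurable N) (hC : Measurable C)
    (hA : ∀ k, Measurable (A k)) (hpos : ∀ᵐ ω ∂P, ∀ k < N ω, 0 < A k ω)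
    (hexp : NonExplosion P N) (hsup : Supercritical P N) :
    SolutionClass (meanPhase (markLaw P N C A ν) Config.nonexplosive) := by
  have hprob := isProbabilityMeasure_markLaw (P := P) (ν := ν) hN hC hA
  have hd := fun (ξ t : ℝ) (ht : t ∈ Ici (0 : ℝ)) =>
    hasDerivWithinAt_meanPhase (ν := ν) hN hC hA hpos ξ ht
  have hcont : ∀ ξ, ContinuousOn
      (fun t => meanPhase (markLaw P N C A ν) Config.nonexplosive t ξ) (Ici 0) :=
    fun ξ t ht => (hd ξ t ht).continuousWithinAt
  refine ⟨fun t ht => ?_, fun ξ => ?_⟩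
  · have hW := aemeasurable_W_configLaw (ν := ν) hN hC hA hpos hexp hsup ht
    refine ⟨(configLaw (markLaw P N C A ν)).map fun m => m.W t,
      Measure.isProbabilityMeasure_map hW, fun ξ => ?_⟩
    rw [meanPhase_nonexplosive hN hC hA hpos hexp hsup ht, charFun_apply_real,
      integral_map hW (by fun_prop)]
    refine integral_congr_ae (ae_of_all _ fun m => ?_)
    simp only
    congr 1
    ring
  · have h1 : (1 : WithTop ℕ∞) = 0 + 1 := rfl
    rw [h1, contDiffOn_succ_iff_derivWithin (uniqueDiffOn_Ici 0)]
    refine ⟨fun t ht => (hd ξ t ht).differentiableWithinAt, by simp, contDiffOn_zero.2 ?_⟩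
    refine ContinuousOn.congr ?_ fun t ht => (hd ξ t ht).derivWithin (uniqueDiffOn_Ici 0 t ht)
    refine ContinuousOn.sub ?_ (hcont ξ)
    refine continuousOn_smoothing hN hC hA (fun t _ => ?_) (fun t _ => ?_) hcont ξ
    · exact continuous_meanPhase_markLaw hN hC hA (Config.measurableSet_nonexplosive t) subset_rfl
    · exact norm_meanPhase_le_one hN hC hA (Config.measurableSet_nonexplosive t)

end Equation

lemma IsIIDConfig.map_eq {Ω : Type*} [MeasurableSpace Ω] {Pr : Measure Ω}
    [IsProbabilityMeasure Pr] {law : Measure Mark} {M : Ω → Config} (h : IsIIDConfig Pr law M) :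
    Pr.map M = configLaw law := by
  have := (iIndepFun_iff_map_fun_eq_infinitePi_map h.measurable).1 h.indep
  simp only [h.law_eq] at this
  exact this

end Kinetic

theorem theorem2p1 {Ω₀ : Type*} [MeasurableSpace Ω₀] (P : Measure Ω₀) [IsProbabilityMeasure P]
    (N : Ω₀ → ℕ) (C : Ω₀ → ℝ) (A : ℕ → Ω₀ → ℝ)
    (hN : Measurable N) (hC : Measurable C) (hA : ∀ k, Measurable (A k))
    (ν : Measure ℝ) [IsProbabilityMeasure ν]
    (hexp : Kinetic.NonExplosion P N)
    (hpos : Kinetic.PositiveWeights P N A)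
    (hnd : Kinetic.NondegenerateWeights P N A)
    (hsup : Kinetic.Supercritical P N) :
    ∃ φ : ℝ → ℝ → ℂ,
      -- existence
      Kinetic.SolutionClass φ ∧
      Kinetic.SolvesKineticEquation P N C A ν φ ∧
      -- uniqueness, as functions on `[0, ∞) × ℝ`
      (∀ ψ : ℝ → ℝ → ℂ, Kinetic.SolutionClass ψ → Kinetic.SolvesKineticEquation P N C A ν ψ →
        ∀ t, 0 ≤ t → ∀ ξ, ψ t ξ = φ t ξ) ∧
      -- probabilistic representation, for every realization of the branching random walk
      ∀ (Ω : Type*) [MeasurableSpace Ω] (Pr : Measure Ω) [IsProbabilityMeasure Pr]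
        (M : Ω → Kinetic.Config),
        Kinetic.IsIIDConfig Pr (Kinetic.markLaw P N C A ν) M →
        ∀ t, 0 ≤ t →
          (∀ᵐ ω ∂Pr, ((M ω).alive t).Finite ∧ ((M ω).dead t).Finite) ∧
          (∀ᵐ ω ∂Pr, Integrable (fun p : ℝ × ℝ => Real.exp p.1 * p.2) ((M ω).allPoints t)) ∧
          AEMeasurable (fun ω => (M ω).W t) Pr ∧
          ∀ ξ : ℝ, φ t ξ = ∫ ω, Complex.exp (Complex.I * ξ * (M ω).W t) ∂Pr := by
  have hpos' := hpos.ae_pos hN hA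
  refine ⟨Kinetic.meanPhase (Kinetic.markLaw P N C A ν) Kinetic.Config.nonexplosive,
    Kinetic.solutionClass_meanPhase hN hC hA hpos' hexp hsup,
    Kinetic.solvesKineticEquation_meanPhase hN hC hA hpos', fun ψ hψ hψs t ht ξ => ?_, ?_⟩
  · exact Kinetic.solution_unique hN hC hA hpos' hexp hsup hψ
      (Kinetic.solutionClass_meanPhase hN hC hA hpos' hexp hsup) hψs
      (Kinetic.solvesKineticEquation_meanPhase hN hC hA hpos') ht ξ
  intro Ω _ Pr _ M hM t ht
  have hprob := Kinetic.isProbabilityMeasure_markLaw (P := P) (ν := ν) hN hC hA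
  have hMm : AEMeasurable M Pr := (measurable_pi_iff.2 hM.measurable).aemeasurable
  have hmap := hM.map_eq
  have hgood : ∀ᵐ ω ∂Pr, M ω ∈ Kinetic.Config.nonnegLifetimes ∧
      M ω ∈ Kinetic.Config.nonexplosive t := by
    refine ae_of_ae_map (p := fun m => m ∈ Kinetic.Config.nonnegLifetimes ∧
      m ∈ Kinetic.Config.nonexplosive t) hMm ?_
    rw [hmap]
    exact (Kinetic.ae_nonnegLifetimes (Kinetic.ae_nonneg_lifetime_markLaw hN hC hA)).and
      (Kinetic.ae_nonexplosive hN hC hA hpos' hexp hsup ht)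
  have hW := Kinetic.aemeasurable_W_configLaw (ν := ν) hN hC hA hpos' hexp hsup ht
  rw [← hmap] at hW
  refine ⟨hgood.mono fun ω h =>
      ⟨Kinetic.Config.finite_alive h.2, Kinetic.Config.finite_dead h.1 h.2⟩,
    hgood.mono fun ω h => Kinetic.Config.integrable_allPoints h.1 h.2,
    hW.comp_aemeasurable hMm, fun ξ => ?_⟩
  have hexpW : Measurable fun w : ℝ => Complex.exp (Complex.I * ξ * w) := by fun_prop
  rw [Kinetic.meanPhase_nonexplosive hN hC hA hpos' hexp hsup ht, ← hmap]
  exact integral_map hMm (hexpW.comp_aemeasurable hW).aestronglyMeasurable
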